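/- Let $n=n_t\ge 2$ and $\eta>0$, and let $\|\cdot\|$ be the Frobenius norm for matrices and the Euclidean norm for vectors. For $l<m$ let $R_{l,m}(\theta,\phi)$ be the $n\times n$ matrix that equals $I$ except that its entries $(l,l)$ and $(m,m)$ are $\cos\theta$, its entry $(m,l)$ is $e^{-i\phi}\sin\theta$ and its entry $(l,m)$ is $-e^{i\phi}\sin\theta$, and let $r_{l,m}(\theta,\phi)$ be its $l$th column. Let $(l_k,m_k)_{k\ge1}$ run cyclically, row by row, through the pairs $l<m$: $(1,2),(1,3),\dots,(1,n),(2,3),\dots,(n-1,n),(1,2),\dots$. For $t\in\mathbb R$ let $T(t)=t$ if $|t|\le\pi/4$ and $T(t)=t-\operatorname{sign}(t)\,\pi/2$ otherwise, with $\operatorname{sign}(t)=1$ for $t>0$ and $-1$ otherwise. Given angles $\theta_k,\phi_k$ $(k\ge1)$ and a Hermitian matrix $G\in\mathbb C^{n\times n}$, put $$W_0=I,\quad W_k=W_{k-1}R_{l_k,m_k}(\theta_k,\phi_k),\quad A_k=W_k^*GW_k,\quad P_k^2=\sum_{i<j}|[A_k]_{ij}|^2 .$$ (i) Let $G$ be any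 Hermitian matrix, and suppose that the angles come from line searches of accuracy $\eta$: for every $k\ge1$ there are a minimum point $\phi_k^{J}$ over $[-\pi,\pi]$ of $\phi\mapsto r_{l_k,m_k}(\pi/4,\phi)^*A_{k-1}\,r_{l_k,m_k}(\pi/4,\phi)$ with $|\phi_k-\phi_k^J|\le\eta$, and a minimum point $\tilde\theta_k$ over $[-\pi/2,\pi/2]$ of $\theta\mapsto r_{l_k,m_k}(\theta,\phi_k)^*A_{k-1}\,r_{l_k,m_k}(\theta,\phi_k)$ with $|\theta_k-T(\tilde\theta_k)|\le\eta$. Then $(P_k^2)_k$ is bounded and $$\limsup_{k\to\infty}P_k^2\le\frac{(n^2-n)(7+2\sqrt2)\,\eta^2\,\|G\|^2}{2^{-(n-2)(n-1)/2}} .\qquad(*)$$ (ii) Let $H\in\mathbb C^{r\times n}$ be any channel matrix, $G=H^*H$, and let the angles be those computed by the One-Bit Null Space Learning Algorithm (OBNSLA), run indefinitely, from the one-bit function $\tilde h(x,y)=1$ if $\|Hx\|\ge\|Hy\|$, $\tilde h(x,y)=-1$ otherwise: $\phi_k$ is the output of the one-bit line search with $L=\pi$ along $x(\phi)=W_{k-1}r_{l_k,m_k}(\pi/4,\phi)$,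 and $\theta_k=T(\tilde\theta_k)$, where $\tilde\theta_k$ is the output of the one-bit line search with $L=\pi/2$ along $x(\theta)=W_{k-1}r_{l_k,m_k}(\theta,\phi_k)$. Then again $(P_k^2)_k$ is bounded and $(*)$ holds. Here the one-bit line search along a curve $x(\cdot)$ puts $a=1$ if $\tilde h(x(-L),x(-L/2))=1$ and $a=0$ otherwise, $b=1$ if $\tilde h(x(0),x(-L/2))=1$ and $b=0$ otherwise, $z=z_{\max}=(3+2b-2a(1+2b))L/4$ and $z_{\min}=z_{\max}-L/2$; while $|z_{\max}-z_{\min}|\ge\eta$ it sets $z=(z_{\max}+z_{\min})/2$ and then replaces $z_{\max}$ by $z$ if $\tilde h(x(z_{\max}),x(z_{\min}))=1$, and $z_{\min}$ by $z$ otherwise; it returns $z$. -/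

import Mathlib

open Filter Set
open scoped Matrix Matrix.Norms.Frobenius

noncomputable section

namespace OBNSLA

/-- The `n × n` rotation matrix `R_{l,m}(θ, φ)`: the identity except that the entries `(l,l)` and
`(m,m)` are `cos θ`, the entry `(m,l)` is `e^{-iφ} sin θ` and the entry `(l,m)` is
`-e^{iφ} sin θ`. -/
def rot {n : ℕ} (l m : Fin n) (θ φ : ℝ) : Matrix (Fin n) (Fin n) ℂ :=
  Matrix.of fun i j =>
    if (i = l ∧ j = l) ∨ (i = m ∧ j = m) then (Real.cos θ : ℂ)
    else if i = m ∧ j = l then Complex.exp (-(Complex.I * (φ : ℂ))) * (Real.sin θ : ℂ)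
    else if i = l ∧ j = m then -(Complex.exp (Complex.I * (φ : ℂ)) * (Real.sin θ : ℂ))
    else if i = j then 1 else 0

/-- The `l`th column `r_{l,m}(θ, φ)` of the rotation matrix `R_{l,m}(θ, φ)`. -/
def rotCol {n : ℕ} (l m : Fin n) (θ φ : ℝ) : Fin n → ℂ := fun i => rot l m θ φ i l

/-- The (real) value of the quadratic form `S(A, x) = x^* A x` of a Hermitian matrix `A`. -/
def S {n : ℕ} (A : Matrix (Fin n) (Fin n) ℂ) (x : Fin n → ℂ) : ℝ := (star x ⬝ᵥ (A *ᵥ x)).re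

/-- The Frobenius norm of the part of `A` strictly above the diagonal. -/
def offNorm {n : ℕ} (A : Matrix (Fin n) (Fin n) ℂ) : ℝ :=
  ‖(Matrix.of fun i j => if i < j then A i j else 0 : Matrix (Fin n) (Fin n) ℂ)‖

/-- The pivot pairs of the cyclic Jacobi technique: the pairs `l < m` are visited row by row,
`(0,1), (0,2), …, (0,n-1), (1,2), …, (n-2,n-1)`, and then again from `(0,1)` on. -/
def pivot (n : ℕ) (hn : 2 ≤ n) : ℕ → Fin n × Fin n
  | 0 => (⟨0, by omega⟩, ⟨1, by omega⟩)
  | k + 1 =>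
    if h : ((pivot n hn k).2 : ℕ) + 1 < n then
      ((pivot n hn k).1, ⟨((pivot n hn k).2 : ℕ) + 1, h⟩)
    else if h : ((pivot n hn k).1 : ℕ) + 2 < n then
      (⟨((pivot n hn k).1 : ℕ) + 1, by omega⟩, ⟨((pivot n hn k).1 : ℕ) + 2, h⟩)
    else (⟨0, by omega⟩, ⟨1, by omega⟩)

/-- `sign x = 1` if `x > 0`, and `-1` otherwise. -/
def sgn (x : ℝ) : ℝ := if 0 < x then 1 else -1

/-- The reduction of an angle of `[-π/2, π/2]` to `[-π/4, π/4]`: `t` itself if it lies in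
`[-π/4, π/4]`, and `t - sign(t) π/2` otherwise. -/
def wrap (t : ℝ) : ℝ :=
  if -(Real.pi / 4) ≤ t ∧ t ≤ Real.pi / 4 then t else t - sgn t * (Real.pi / 2)

/-- `x` is a minimum point of `f` over the set `s`. -/
def IsArgmin (f : ℝ → ℝ) (s : Set ℝ) (x : ℝ) : Prop := x ∈ s ∧ ∀ y ∈ s, f x ≤ f y

/-- The accumulated rotations `W_0 = I`, `W_{k+1} = W_k R_{l,m}(θ, φ)`, with the `k`th pivot pair
`(l, m)` and the `k`th angles `θ = θ k`, `φ = φ k`. -/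
def W {n : ℕ} (hn : 2 ≤ n) (θ φ : ℕ → ℝ) : ℕ → Matrix (Fin n) (Fin n) ℂ
  | 0 => 1
  | k + 1 => W hn θ φ k * rot (pivot n hn k).1 (pivot n hn k).2 (θ k) (φ k)

/-- The angles `θ k`, `φ k` are obtained by line searches of accuracy `η`. For every stage `k`, with
`A = W_k^* G W_k` and the pivot pair `(l, m)`:
* `φ k` is within `η` of a minimum point over `[-π, π]` of `φ ↦ S(A, r_{l,m}(π/4, φ))`;
* `θ k` is within `η` of the reduction to `[-π/4, π/4]` of a minimum point over `[-π/2, π/2]` of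
  `θ ↦ S(A, r_{l,m}(θ, φ k))`. -/
def SearchAccuracy {n : ℕ} (hn : 2 ≤ n) (G : Matrix (Fin n) (Fin n) ℂ) (η : ℝ)
    (θ φ : ℕ → ℝ) : Prop :=
  ∀ k : ℕ,
    (∃ φJ : ℝ,
      IsArgmin (fun t => S ((W hn θ φ k)ᴴ * G * W hn θ φ k)
        (rotCol (pivot n hn k).1 (pivot n hn k).2 (Real.pi / 4) t))
        (Icc (-Real.pi) Real.pi) φJ ∧
      |φ k - φJ| ≤ η) ∧
    (∃ θt : ℝ,
      IsArgmin (fun t => S ((W hn θ φ k)ᴴ * G * W hn θ φ k)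
        (rotCol (pivot n hn k).1 (pivot n hn k).2 t (φ k)))
        (Icc (-(Real.pi / 2)) (Real.pi / 2)) θt ∧
      |θ k - wrap θt| ≤ η)

/-- The one-bit observation: `1` if `‖H x‖ ≥ ‖H y‖` (Euclidean norms), and `-1` otherwise. -/
def oneBit {r n : ℕ} (H : Matrix (Fin r) (Fin n) ℂ) (x y : Fin n → ℂ) : ℤ :=
  if ‖WithLp.toLp 2 (H *ᵥ x)‖ ≥ ‖WithLp.toLp 2 (H *ᵥ y)‖ then 1 else -1

/-- The variables `zmin`, `zmax`, `z` of the one-bit line search. -/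
structure SearchState where
  zmin : ℝ
  zmax : ℝ
  z : ℝ

/-- The initial bracket of the one-bit line search over `[-L, L]` along the curve `x`, from the bits
`a` (is `x (-L)` at least as bad as `x (-L/2)`?) and `b` (is `x 0` at least as bad as `x (-L/2)`?),
with truth values `0`, `1`. It is `[-3L/4, -L/4]`, `[-L/4, L/4]`, `[L/4, 3L/4]`, `[3L/4, 5L/4]` for
`(a, b) = (1,1), (1,0), (0,0), (0,1)`. -/
def searchInit {n : ℕ} (h : (Fin n → ℂ) → (Fin n → ℂ) → ℤ) (L : ℝ) (x : ℝ → Fin n → ℂ) :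
    SearchState :=
  let a : ℝ := if h (x (-L)) (x (-(L / 2))) = 1 then 1 else 0
  let b : ℝ := if h (x 0) (x (-(L / 2))) = 1 then 1 else 0
  let zmax : ℝ := (3 + 2 * b - 2 * a * (1 + 2 * b)) * L / 4
  ⟨zmax - L / 2, zmax, zmax⟩

/-- One pass of the loop of the one-bit line search: the end points are compared by one bit, and the
end point that is not better is replaced by the midpoint `z`. -/
def searchStep {n : ℕ} (h : (Fin n → ℂ) → (Fin n → ℂ) → ℤ) (x : ℝ → Fin n → ℂ)
    (s : SearchState) : SearchState :=
  let z : ℝ := (s.zmax + s.zmin) / 2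
  if h (x s.zmax) (x s.zmin) = 1 then ⟨s.zmin, z, z⟩ else ⟨z, s.zmax, z⟩

/-- The one-bit line search: the loop is run while `|zmax - zmin| ≥ η`, so that the number of passes
is the first `i` for which the bracket after `i` passes is shorter than `η`; the output is `z`. -/
def oneBitLineSearch {n : ℕ} (h : (Fin n → ℂ) → (Fin n → ℂ) → ℤ) (L η : ℝ)
    (x : ℝ → Fin n → ℂ) : ℝ :=
  ((searchStep h x)^[sInf {i : ℕ |
    |((searchStep h x)^[i] (searchInit h L x)).zmax
      - ((searchStep h x)^[i] (searchInit h L x)).zmin| < η}] (searchInit h L x)).z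

/-- The first line search of a stage, along `φ ↦ V r_{l,m}(π/4, φ)` with `φ ∈ [-π, π]`. -/
def phiHat {n : ℕ} (h : (Fin n → ℂ) → (Fin n → ℂ) → ℤ) (η : ℝ)
    (V : Matrix (Fin n) (Fin n) ℂ) (l m : Fin n) : ℝ :=
  oneBitLineSearch h Real.pi η (fun t => V *ᵥ rotCol l m (Real.pi / 4) t)

/-- The second line search of a stage, along `θ ↦ V r_{l,m}(θ, φ)` with `θ ∈ [-π/2, π/2]` and `φ` the
outcome of the first line search, followed by the reduction to `[-π/4, π/4]`. -/
def thetaHat {n : ℕ} (h : (Fin n → ℂ) → (Fin n → ℂ) → ℤ) (η : ℝ)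
    (V : Matrix (Fin n) (Fin n) ℂ) (l m : Fin n) : ℝ :=
  wrap (oneBitLineSearch h (Real.pi / 2) η (fun t => V *ᵥ rotCol l m t (phiHat h η V l m)))

/-- The matrices `W_k` of the one-bit null space learning algorithm. The algorithm has access to the
channel only through the one-bit function `h`. -/
def algW {n : ℕ} (hn : 2 ≤ n) (h : (Fin n → ℂ) → (Fin n → ℂ) → ℤ) (η : ℝ) :
    ℕ → Matrix (Fin n) (Fin n) ℂ
  | 0 => 1
  | k + 1 =>
    algW hn h η k *
      rot (pivot n hn k).1 (pivot n hn k).2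
        (thetaHat h η (algW hn h η k) (pivot n hn k).1 (pivot n hn k).2)
        (phiHat h η (algW hn h η k) (pivot n hn k).1 (pivot n hn k).2)

/-- The asymptotic bound `(n² - n)(7 + 2√2) η² ‖G‖² / 2^{-(n-2)(n-1)/2}`, with the Frobenius norm
`‖G‖`. -/
def bound (n : ℕ) (η : ℝ) (G : Matrix (Fin n) (Fin n) ℂ) : ℝ :=
  (((n : ℝ) ^ 2 - n) * (7 + 2 * Real.sqrt 2) * η ^ 2 * ‖G‖ ^ 2)
    / (2 : ℝ) ^ (-(((n : ℝ) - 2) * ((n : ℝ) - 1) / 2))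

end OBNSLA

end

/-! Every stage is a Jacobi rotation that nearly annihilates its pivot. Write the rotated pivot
entry as `e^{iφ}(g + iy)`. Then `2g` is the θ-derivative of the second line-search objective, and
`y` is the φ-derivative of the first one (`pivot_entry_sq`). Both objectives have the form `C + p
cos + q sin`, so angles within `η` of critical points leave a pivot of squared modulus at most `ε =
(5/2) η² ‖G‖²` (`ApproxAngles.pivot_entry_le`). Only criticality is used, never minimality. The two
halves of the theorem therefore differ only in how `ApproxAngles` is obtained: from minimum points,
or from a bisection, since comparing the ends of a short bracket reveals the sign of the derivative
at its midpoint.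

If the pivots were annihilated exactly, with `cos² θ ≥ κ`, a cyclic sweep would multiply the
off-diagonal sum of squares by at most `1 - κ^M`, where `M = (n-1)(n-2)/2` (`sweep_contraction`).
Treating a row moves a definite share of the mass into the block below it, later rotations keep the
mass of the finished row, and the smaller block is handled by induction.

To pass to inexact pivots, the off-diagonal part `v` is compared with a process `w` that starts at
the same point and undergoes the same rotations, but has its pivot set to zero each time. With `X`
the off-diagonal sum of squares, `X(v) - X(w)/2 + X(v - w)` grows by at most `4ε` per rotation. This
costs half of the contraction but makes the error linear in `ε`, hence of order `η²`
(`ApproxJacobi.sweep`). Iterating gives `limsup P² ≤ (4/κ^M + 1) T ε` for sweeps of length `T`.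

The reduction of θ gives `κ = 1/2 - η`. When `η` is small relative to `n`, the constants fit;
otherwise the claimed bound already exceeds the trivial estimate `P² ≤ ‖G‖²/2`
(`ApproxJacobi.limsup_le`). -/

open scoped ComplexConjugate

namespace OBNSLA

/-! ### Sums of squared entries under plane rotations -/

/-- Sum of the entries of `e` with both indices in `[l, m)`. -/
def blockSum (l m : ℕ) (e : ℕ → ℕ → ℝ) : ℝ :=
  ∑ j ∈ Finset.Ico l m, ∑ i ∈ Finset.Ico l m, e i j

/-- Symmetric, nonnegative, with zero diagonal. -/
structure SymmEnt (e : ℕ → ℕ → ℝ) : Prop where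
  nonneg : ∀ i j, 0 ≤ e i j
  symm : ∀ i j, e i j = e j i
  diag : ∀ i, e i i = 0

/-- The squared absolute values of the off-diagonal entries change as under a unitary rotation in
the `(l, m)` plane; nothing is said about the entry `(l, m)`. -/
structure EntStep (l m : ℕ) (e e' : ℕ → ℕ → ℝ) : Prop where
  pair : ∀ j, j ≠ l → j ≠ m → e' l j + e' m j = e l j + e m j
  same : ∀ i j, i ≠ l → i ≠ m → j ≠ l → j ≠ m → e' i j = e i j

/-- A rotation that annihilates the entry `(l, m)`, with `cos² ≥ κ`. -/
structure AnnihStep (κ : ℝ) (l m : ℕ) (e e' : ℕ → ℕ → ℝ) : Prop extends EntStep l m e e' where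
  zero : e' l m = 0
  mix : ∀ K, 0 ≤ K → K ≤ 1 → ∀ j, j ≠ l → j ≠ m →
    (1 - K) * e' l j ≤ (1 - κ * K) * (e l j + (1 - K) * e m j)
  mix_zero : ∀ j, j ≠ l → j ≠ m → e l j = 0 → e' l j ≤ (1 - κ) * e m j

lemma sum_split_pair {I : Finset ℕ} {p q : ℕ} (hp : p ∈ I) (hq : q ∈ I) (hpq : p ≠ q)
    (f : ℕ → ℝ) : ∑ i ∈ I, f i = f p + f q + ∑ i ∈ (I.erase p).erase q, f i := by
  rw [← Finset.add_sum_erase I f hp,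
    ← Finset.add_sum_erase (I.erase p) f (Finset.mem_erase.2 ⟨hpq.symm, hq⟩)]
  ring

lemma sum_eq_of_pair {I : Finset ℕ} {p q : ℕ} (hp : p ∈ I) (hq : q ∈ I) (hpq : p ≠ q)
    {f g : ℕ → ℝ} (h : f p + f q = g p + g q) (h' : ∀ i, i ≠ p → i ≠ q → f i = g i) :
    ∑ i ∈ I, f i = ∑ i ∈ I, g i := by
  rw [sum_split_pair hp hq hpq f, sum_split_pair hp hq hpq g, h]
  congr 1
  refine Finset.sum_congr rfl fun i hi => ?_
  simp only [Finset.mem_erase] at hi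
  exact h' i hi.2.1 hi.1

lemma blockSum_nonneg {e : ℕ → ℕ → ℝ} (he : SymmEnt e) (l m : ℕ) : 0 ≤ blockSum l m e :=
  Finset.sum_nonneg fun _ _ => Finset.sum_nonneg fun _ _ => he.nonneg _ _

lemma blockSum_succ_top {e : ℕ → ℕ → ℝ} (he : SymmEnt e) {l m : ℕ} (h : l ≤ m) :
    blockSum l (m + 1) e = blockSum l m e + 2 * ∑ i ∈ Finset.Ico l m, e i m := by
  unfold blockSum
  rw [Finset.sum_Ico_succ_top h, Finset.sum_Ico_succ_top h, he.diag]
  simp only [Finset.sum_Ico_succ_top h, Finset.sum_add_distrib]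
  have : ∑ j ∈ Finset.Ico l m, e m j = ∑ j ∈ Finset.Ico l m, e j m :=
    Finset.sum_congr rfl fun j _ => he.symm _ _
  rw [this]; ring

lemma blockSum_bot {e : ℕ → ℕ → ℝ} (he : SymmEnt e) {l n : ℕ} (h : l < n) :
    blockSum l n e
      = 2 * ∑ j ∈ Finset.Ico (l + 1) n, e l j + blockSum (l + 1) n e := by
  unfold blockSum
  rw [Finset.sum_eq_sum_Ico_succ_bot h, Finset.sum_eq_sum_Ico_succ_bot h, he.diag]
  simp only [Finset.sum_eq_sum_Ico_succ_bot h, Finset.sum_add_distrib]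
  have : ∑ j ∈ Finset.Ico (l + 1) n, e j l = ∑ j ∈ Finset.Ico (l + 1) n, e l j :=
    Finset.sum_congr rfl fun j _ => he.symm _ _
  rw [this]; ring

/-- A rotation only changes the sum through the entry `(l, m)`. -/
lemma EntStep.blockSum_eq {l m b n : ℕ} {e e' : ℕ → ℕ → ℝ} (h : EntStep l m e e')
    (he : SymmEnt e) (he' : SymmEnt e') (hb : b ≤ l) (hlm : l < m) (hm : m < n) :
    blockSum b n e' = blockSum b n e - 2 * e l m + 2 * e' l m := by
  have hl' : l ∈ Finset.Ico b n := Finset.mem_Ico.2 ⟨hb, by omega⟩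
  have hm' : m ∈ Finset.Ico b n := Finset.mem_Ico.2 ⟨by omega, hm⟩
  unfold blockSum
  rw [sum_split_pair hl' hm' hlm.ne, sum_split_pair hl' hm' hlm.ne (fun j => ∑ i ∈ _, e i j),
    ← Finset.sum_add_distrib, ← Finset.sum_add_distrib,
    sum_split_pair hl' hm' hlm.ne (fun i => e' i l + e' i m),
    sum_split_pair hl' hm' hlm.ne (fun i => e i l + e i m)]
  have h1 : ∑ i ∈ ((Finset.Ico b n).erase l).erase m, (e' i l + e' i m)
      = ∑ i ∈ ((Finset.Ico b n).erase l).erase m, (e i l + e i m) := by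
    refine Finset.sum_congr rfl fun i hi => ?_
    simp only [Finset.mem_erase] at hi
    rw [he'.symm i l, he'.symm i m, he.symm i l, he.symm i m, h.pair i hi.2.1 hi.1]
  have h2 : ∑ j ∈ ((Finset.Ico b n).erase l).erase m, ∑ i ∈ Finset.Ico b n, e' i j
      = ∑ j ∈ ((Finset.Ico b n).erase l).erase m, ∑ i ∈ Finset.Ico b n, e i j := by
    refine Finset.sum_congr rfl fun j hj => ?_
    simp only [Finset.mem_erase] at hj
    exact sum_eq_of_pair hl' hm' hlm.ne (h.pair j hj.2.1 hj.1)
      fun i hi hi' => h.same i j hi hi' hj.2.1 hj.1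
  rw [h1, h2, he.diag, he.diag, he'.diag, he'.diag, he.symm m l, he'.symm m l]
  ring

/-- A rotation in a plane `(l, m)` with `b < l` keeps the norm of the row `b`. -/
lemma EntStep.row_eq {l m b n : ℕ} {e e' : ℕ → ℕ → ℝ} (h : EntStep l m e e')
    (he : SymmEnt e) (he' : SymmEnt e') (hb : b < l) (hlm : l < m) (hm : m < n) :
    ∑ j ∈ Finset.Ico (b + 1) n, e' b j = ∑ j ∈ Finset.Ico (b + 1) n, e b j := by
  refine sum_eq_of_pair (p := l) (q := m) (Finset.mem_Ico.2 ⟨hb, by omega⟩)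
    (Finset.mem_Ico.2 ⟨by omega, hm⟩) hlm.ne ?_ ?_
  · rw [he'.symm b l, he'.symm b m, he.symm b l, he.symm b m]
    exact h.pair b hb.ne (by omega)
  · intro i hi hi'
    exact h.same b i hb.ne (by omega) hi hi'

/-- The first row after the rotations `(l, l+1), …, (l, m-1)`. -/
lemma row_phase {κ : ℝ} (hκ0 : 0 ≤ κ) (hκ1 : κ ≤ 1) {l n : ℕ} (e : ℕ → ℕ → ℕ → ℝ)
    (he : ∀ t, SymmEnt (e t)) (a : ℕ) (ha : l + a + 1 ≤ n)
    (hs : ∀ t < a, AnnihStep κ l (l + 1 + t) (e t) (e (t + 1))) :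
    (∀ m' p, l + a + 1 ≤ m' → m' ≤ p →
      ∑ i ∈ Finset.Ico l m', e a i p = ∑ i ∈ Finset.Ico l m', e 0 i p) ∧
    2 * ∑ j ∈ Finset.Ico (l + 1) (l + a + 1), e a l j
      ≤ (1 - κ ^ (a - 1)) * blockSum l (l + a + 1) (e 0) := by
  induction a with
  | zero => simp
  | succ a ih =>
    obtain ⟨ih1, ih2⟩ := ih (by omega) fun t ht => hs t (by omega)
    have h := hs a (by omega)
    set m := l + 1 + a with hmdef
    have hm1 : l + a + 1 = m := by omega
    have hm2 : l + (a + 1) + 1 = m + 1 := by omega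
    rw [hm1] at ih1 ih2
    rw [hm2]
    constructor
    · intro m' p hm' hp
      rw [← ih1 m' p (by omega) hp]
      refine sum_eq_of_pair (p := l) (q := m) (Finset.mem_Ico.2 ⟨le_rfl, by omega⟩)
        (Finset.mem_Ico.2 ⟨by omega, by omega⟩) (by omega) (h.pair p (by omega) (by omega)) ?_
      intro i hi hi'
      exact h.same i p hi hi' (by omega) (by omega)
    -- The column `m` still has its initial mass in the rows `l, …, m-1`, so the enlarged block can
    -- be measured with the current entries.
    · rw [Finset.sum_Ico_succ_top (by omega), h.zero, add_zero,
        blockSum_succ_top (he 0) (by omega), ← ih1 m m le_rfl le_rfl,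
        Finset.sum_eq_sum_Ico_succ_bot (by omega : l < m) (fun i => e a i m)]
      have hsymm : ∑ j ∈ Finset.Ico (l + 1) m, e a j m = ∑ j ∈ Finset.Ico (l + 1) m, e a m j :=
        Finset.sum_congr rfl fun j _ => (he a).symm _ _
      rw [hsymm]
      have hx0 : 0 ≤ e a l m := (he a).nonneg _ _
      have hB0 : 0 ≤ ∑ j ∈ Finset.Ico (l + 1) m, e a m j :=
        Finset.sum_nonneg fun j _ => (he a).nonneg _ _
      have hX0 : 0 ≤ blockSum l m (e 0) := blockSum_nonneg (he 0) _ _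
      have hR0 : 0 ≤ ∑ j ∈ Finset.Ico (l + 1) m, e a l j :=
        Finset.sum_nonneg fun j _ => (he a).nonneg _ _
      have hne : ∀ j ∈ Finset.Ico (l + 1) m, j ≠ l ∧ j ≠ m := fun j hj => by
        rw [Finset.mem_Ico] at hj; omega
      -- For the first rotation the row consists of the annihilated entry alone; the truncated
      -- exponent is 0 and both sides vanish.
      rcases Nat.eq_zero_or_pos a with h0 | hapos
      · subst h0
        have : Finset.Ico (l + 1) m = ∅ := by simp [hmdef]
        rw [this]
        simp
      obtain ⟨a', rfl⟩ : ∃ a', a = a' + 1 := ⟨a - 1, by omega⟩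
      simp only [Nat.add_sub_cancel] at ih2 ⊢
      have hK0 : 0 ≤ κ ^ a' := pow_nonneg hκ0 _
      have hK1 : κ ^ a' ≤ 1 := pow_le_one₀ hκ0 hκ1
      have hκK : κ ^ (a' + 1) = κ * κ ^ a' := by ring
      set K := κ ^ a' with hK
      have hκK1 : κ * K ≤ 1 := by nlinarith
      rw [hκK]
      -- The weighted inequality `mix` needs division by `1 - K`. If `K = 1`, the row is already
      -- zero and `mix_zero` replaces it.
      rcases eq_or_lt_of_le hK1 with hKe | hKlt
      · rw [hKe] at ih2 ⊢
        have hR : ∑ j ∈ Finset.Ico (l + 1) m, e (a' + 1) l j = 0 := by linarith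
        have hz := (Finset.sum_eq_zero_iff_of_nonneg fun j _ => (he (a' + 1)).nonneg l j).1 hR
        have : ∑ j ∈ Finset.Ico (l + 1) m, e (a' + 1 + 1) l j
            ≤ ∑ j ∈ Finset.Ico (l + 1) m, (1 - κ) * e (a' + 1) m j :=
          Finset.sum_le_sum fun j hj =>
            h.mix_zero j (hne j hj).1 (hne j hj).2 (hz j hj)
        rw [← Finset.mul_sum] at this
        nlinarith [mul_nonneg (sub_nonneg.2 hκ1) hx0, mul_nonneg (sub_nonneg.2 hκ1) hX0]
      · have : ∑ j ∈ Finset.Ico (l + 1) m, (1 - K) * e (a' + 1 + 1) l j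
            ≤ ∑ j ∈ Finset.Ico (l + 1) m,
              (1 - κ * K) * (e (a' + 1) l j + (1 - K) * e (a' + 1) m j) :=
          Finset.sum_le_sum fun j hj => h.mix K hK0 hK1 j (hne j hj).1 (hne j hj).2
        rw [← Finset.mul_sum, ← Finset.mul_sum, Finset.sum_add_distrib, ← Finset.mul_sum] at this
        have hpos : 0 < 1 - K := by linarith
        refine le_of_mul_le_mul_left ?_ hpos
        have h3 := mul_le_mul_of_nonneg_left ih2 (sub_nonneg.2 hκK1)
        have h4 := mul_nonneg (sub_nonneg.2 hκK1) (mul_nonneg hpos.le hx0)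
        linarith

/-! ### The cyclic order of the pivots -/

/-- The `k`th pivot pair is `(l, m)`. -/
def PivotAt {n : ℕ} (hn : 2 ≤ n) (k l m : ℕ) : Prop :=
  ((pivot n hn k).1 : ℕ) = l ∧ ((pivot n hn k).2 : ℕ) = m

lemma pivot_lt {n : ℕ} (hn : 2 ≤ n) (k : ℕ) : (pivot n hn k).1 < (pivot n hn k).2 := by
  induction k with
  | zero => simp [pivot]
  | succ k ih =>
    rw [Fin.lt_def] at ih ⊢
    rw [pivot]
    split_ifs <;> (simp; try omega)

lemma pivotAt_zero {n : ℕ} (hn : 2 ≤ n) : PivotAt hn 0 0 1 := by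
  simp [PivotAt, pivot]

lemma PivotAt.next {n : ℕ} {hn : 2 ≤ n} {k l m : ℕ} (h : PivotAt hn k l m) (hm : m + 1 < n) :
    PivotAt hn (k + 1) l (m + 1) := by
  obtain ⟨rfl, rfl⟩ := h
  simp [PivotAt, pivot, hm]

lemma PivotAt.next_row {n : ℕ} {hn : 2 ≤ n} {k l m : ℕ} (h : PivotAt hn k l m) (hm : m + 1 = n)
    (hl : l + 2 < n) : PivotAt hn (k + 1) (l + 1) (l + 2) := by
  obtain ⟨rfl, rfl⟩ := h
  simp [PivotAt, pivot, hm, hl]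

lemma PivotAt.next_sweep {n : ℕ} {hn : 2 ≤ n} {k l m : ℕ} (h : PivotAt hn k l m) (hm : m + 1 = n)
    (hl : l + 2 = n) : PivotAt hn (k + 1) 0 1 := by
  obtain ⟨rfl, rfl⟩ := h
  simp [PivotAt, pivot, hm, hl]

lemma PivotAt.row {n : ℕ} {hn : 2 ≤ n} {k l : ℕ} (h : PivotAt hn k l (l + 1)) (i : ℕ)
    (hi : l + 1 + i < n) : PivotAt hn (k + i) l (l + 1 + i) := by
  induction i with
  | zero => exact h
  | succ i ih => exact (ih (by omega)).next hi

/-- The number of rotations in a sweep of a matrix of size `a + 1`. -/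
def sweepLength (a : ℕ) : ℕ := ∑ i ∈ Finset.range (a + 1), i

/-- The exponent in the contraction factor of a sweep of a matrix of size `a + 1`. -/
def sweepExp (a : ℕ) : ℕ := ∑ i ∈ Finset.range a, i

lemma sweepLength_succ (a : ℕ) : sweepLength (a + 1) = (a + 1) + sweepLength a := by
  rw [sweepLength, Finset.sum_range_succ, add_comm, sweepLength]

lemma sweepExp_succ (a : ℕ) : sweepExp (a + 1) = sweepExp a + a := by
  rw [sweepExp, Finset.sum_range_succ, sweepExp]

lemma pivotAt_sweep {n : ℕ} {hn : 2 ≤ n} (a : ℕ) : ∀ {k l : ℕ}, l + (a + 1) + 1 = n →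
    PivotAt hn k l (l + 1) → PivotAt hn (k + sweepLength (a + 1)) 0 1 := by
  induction a with
  | zero =>
    intro k l hl h
    simpa [sweepLength, Finset.sum_range_succ] using (h.row 0 (by omega)).next_sweep (by omega) (by omega)
  | succ a ih =>
    intro k l hl h
    rw [sweepLength_succ, ← add_assoc]
    refine ih (l := l + 1) (by omega) ?_
    exact (h.row (a + 1) (by omega)).next_row (by omega) (by omega)

/-! ### Contraction over an exact sweep -/

/-- A sweep of exact annihilations contracts the sum of the off-diagonal squares. -/
theorem sweep_contraction {κ : ℝ} (hκ0 : 0 ≤ κ) (hκ1 : κ ≤ 1) {n : ℕ} (hn : 2 ≤ n)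
    (e : ℕ → ℕ → ℕ → ℝ) (he : ∀ t, SymmEnt (e t)) (k₀ : ℕ)
    (hs : ∀ t, AnnihStep κ (pivot n hn (k₀ + t)).1 (pivot n hn (k₀ + t)).2 (e t) (e (t + 1)))
    (a : ℕ) : ∀ t l : ℕ, l + a + 1 = n → (a ≠ 0 → PivotAt hn (k₀ + t) l (l + 1)) →
      blockSum l n (e (t + sweepLength a)) ≤ (1 - κ ^ sweepExp a) * blockSum l n (e t) ∧
      ∀ b < l, ∑ j ∈ Finset.Ico (b + 1) n, e (t + sweepLength a) b j
        = ∑ j ∈ Finset.Ico (b + 1) n, e t b j := by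
  induction a with
  | zero =>
    intro t l hl _
    have : n = l + 1 := by omega
    subst this
    simp [sweepLength, sweepExp, blockSum, (he t).diag]
  | succ a ih =>
    intro t l hl hp
    have hp := hp (by omega)
    have hstep : ∀ i < a + 1, AnnihStep κ l (l + 1 + i) (e (t + i)) (e (t + (i + 1))) := by
      intro i hi
      have h := hs (t + i)
      obtain ⟨h1, h2⟩ := hp.row i (by omega)
      rwa [← add_assoc k₀, h1, h2] at h
    have hmid : ∀ i ≤ a + 1, blockSum l n (e (t + i)) ≤ blockSum l n (e t) ∧
        ∀ b < l, ∑ j ∈ Finset.Ico (b + 1) n, e (t + i) b j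
          = ∑ j ∈ Finset.Ico (b + 1) n, e t b j := by
      intro i
      induction i with
      | zero => simp
      | succ i ihi =>
        intro hi
        obtain ⟨h1, h2⟩ := ihi (by omega)
        have hst := hstep i (by omega)
        constructor
        · have := hst.blockSum_eq (b := l) (n := n) (he _) (he _) le_rfl (by omega) (by omega)
          rw [hst.zero] at this
          linarith [(he (t + i)).nonneg l (l + 1 + i)]
        · intro b hb
          rw [← h2 b hb]
          exact hst.row_eq (he _) (he _) hb (by omega) (by omega)
    obtain ⟨hm1, hm2⟩ := hmid (a + 1) le_rfl
    obtain ⟨-, hrow⟩ := row_phase (n := n) hκ0 hκ1 (fun i => e (t + i)) (fun i => he _) (a + 1)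
      (by omega) hstep
    have hnext : a ≠ 0 → PivotAt hn (k₀ + (t + (a + 1))) (l + 1) (l + 1 + 1) := fun ha => by
      rw [← add_assoc k₀, ← add_assoc (k₀ + t)]
      exact (hp.row a (by omega)).next_row (by omega) (by omega)
    obtain ⟨hq1, hq2⟩ := ih (t + (a + 1)) (l + 1) (by omega) hnext
    rw [sweepLength_succ, ← add_assoc]
    refine ⟨?_, fun b hb => by rw [hq2 b (by omega), hm2 b hb]⟩
    rw [sweepExp_succ, blockSum_bot (he _) (by omega), hq2 l (by omega)]
    rw [blockSum_bot (he _) (by omega)] at hm1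
    simp only [Nat.add_sub_cancel, add_zero, hl] at hrow
    set c := κ ^ sweepExp a
    have hc0 : 0 ≤ c := pow_nonneg hκ0 _
    have hc1 : c ≤ 1 := pow_le_one₀ hκ0 hκ1
    rw [pow_add]
    -- With `r` the doubled row sum and `X` the initial block sum, the new sum is at most `r +
    -- (1-c)(X - r) = (1-c)X + cr`, and `r ≤ (1 - κ^a)X`.
    nlinarith [mul_le_mul_of_nonneg_left hm1 (sub_nonneg.2 hc1),
      mul_le_mul_of_nonneg_left hrow hc0]

/-! ### Frobenius norm -/

lemma frobenius_sq {r n : ℕ} (A : Matrix (Fin r) (Fin n) ℂ) :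
    ‖A‖ ^ 2 = ∑ i, ∑ j, ‖A i j‖ ^ 2 := by
  have h0 : 0 ≤ ∑ i, ∑ j, ‖A i j‖ ^ (2 : ℝ) :=
    Finset.sum_nonneg fun _ _ => Finset.sum_nonneg fun _ _ => by positivity
  rw [Matrix.frobenius_norm_def, ← Real.sqrt_eq_rpow, Real.sq_sqrt h0]
  norm_cast

lemma frobenius_sq_eq_trace {n : ℕ} (A : Matrix (Fin n) (Fin n) ℂ) :
    ((‖A‖ ^ 2 : ℝ) : ℂ) = (Aᴴ * A).trace := by
  rw [frobenius_sq, Matrix.trace, Finset.sum_comm]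
  simp [Matrix.mul_apply, ← Complex.normSq_eq_conj_mul_self, Complex.normSq_eq_norm_sq]

lemma frobenius_unitary_conj {n : ℕ} (A U : Matrix (Fin n) (Fin n) ℂ) (hU : Uᴴ * U = 1) :
    ‖Uᴴ * A * U‖ ^ 2 = ‖A‖ ^ 2 := by
  have hU' : U * Uᴴ = 1 := mul_eq_one_comm.1 hU
  have h : ((‖Uᴴ * A * U‖ ^ 2 : ℝ) : ℂ) = ((‖A‖ ^ 2 : ℝ) : ℂ) := by
    rw [frobenius_sq_eq_trace, frobenius_sq_eq_trace]
    have : (Uᴴ * A * U)ᴴ * (Uᴴ * A * U) = Uᴴ * (Aᴴ * A * U) := by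
      simp only [Matrix.conjTranspose_mul, Matrix.conjTranspose_conjTranspose, Matrix.mul_assoc]
      rw [← Matrix.mul_assoc U, hU', Matrix.one_mul]
    rw [this, Matrix.trace_mul_comm, Matrix.mul_assoc, hU', Matrix.mul_one]
  exact_mod_cast h

lemma sum_four_le_frobenius_sq {n : ℕ} (A : Matrix (Fin n) (Fin n) ℂ) {l m : Fin n}
    (h : l ≠ m) :
    ‖A l l‖ ^ 2 + ‖A l m‖ ^ 2 + (‖A m l‖ ^ 2 + ‖A m m‖ ^ 2) ≤ ‖A‖ ^ 2 := by
  rw [frobenius_sq]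
  calc _ = ∑ i ∈ {l, m}, ∑ j ∈ {l, m}, ‖A i j‖ ^ 2 := by simp [Finset.sum_pair h]
    _ ≤ ∑ i ∈ {l, m}, ∑ j, ‖A i j‖ ^ 2 := Finset.sum_le_sum fun i _ =>
        Finset.sum_le_sum_of_subset_of_nonneg (Finset.subset_univ _) fun _ _ _ => by positivity
    _ ≤ _ := Finset.sum_le_sum_of_subset_of_nonneg (Finset.subset_univ _) fun _ _ _ =>
        Finset.sum_nonneg fun _ _ => by positivity

/-! ### Rotations -/

/-- The complex sine `e^{iφ} sin θ` of the rotation `R_{l,m}(θ, φ)`. -/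
noncomputable def csin (θ φ : ℝ) : ℂ := Complex.exp (Complex.I * φ) * (Real.sin θ : ℂ)

lemma conj_csin (θ φ : ℝ) :
    conj (csin θ φ) = Complex.exp (-(Complex.I * φ)) * (Real.sin θ : ℂ) := by
  simp [csin, ← Complex.exp_conj, -Complex.ofReal_sin]

lemma norm_csin_sq (θ φ : ℝ) : ‖csin θ φ‖ ^ 2 = Real.sin θ ^ 2 := by
  rw [csin, norm_mul, mul_comm Complex.I, Complex.norm_exp_ofReal_mul_I, one_mul,
    Complex.norm_real, Real.norm_eq_abs, sq_abs]

lemma rot_apply_left {n : ℕ} {l m : Fin n} (h : l ≠ m) (θ φ : ℝ) (k : Fin n) :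
    rot l m θ φ k l
      = if k = l then (Real.cos θ : ℂ) else if k = m then conj (csin θ φ) else 0 := by
  rw [conj_csin]
  by_cases h1 : k = l
  · simp [rot, h1]
  · by_cases h2 : k = m
    · simp [rot, h2, h.symm, h]
    · simp [rot, h1, h2]

lemma rot_apply_right {n : ℕ} {l m : Fin n} (h : l ≠ m) (θ φ : ℝ) (k : Fin n) :
    rot l m θ φ k m
      = if k = l then -csin θ φ else if k = m then (Real.cos θ : ℂ) else 0 := by
  by_cases h1 : k = l
  · simp [rot, h1, h, h.symm, csin]
  · by_cases h2 : k = m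
    · simp [rot, h2, h.symm]
    · simp [rot, h1, h2]

lemma rot_apply_of_ne {n : ℕ} {l m j : Fin n} (hl : j ≠ l) (hm : j ≠ m) (θ φ : ℝ) (k : Fin n) :
    rot l m θ φ k j = if k = j then 1 else 0 := by
  simp [rot, hl, hm]

lemma mul_rot_left {r n : ℕ} {l m : Fin n} (h : l ≠ m) (θ φ : ℝ)
    (B : Matrix (Fin r) (Fin n) ℂ) (i : Fin r) :
    (B * rot l m θ φ) i l = B i l * Real.cos θ + B i m * conj (csin θ φ) := by
  rw [Matrix.mul_apply, Finset.sum_eq_add l m h]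
  · simp only [rot_apply_left h, if_true, if_neg h.symm]
  · intro k _ hk
    simp [rot_apply_left h, hk.1, hk.2]
  · simp
  · simp

lemma mul_rot_right {r n : ℕ} {l m : Fin n} (h : l ≠ m) (θ φ : ℝ)
    (B : Matrix (Fin r) (Fin n) ℂ) (i : Fin r) :
    (B * rot l m θ φ) i m = -(B i l * csin θ φ) + B i m * Real.cos θ := by
  rw [Matrix.mul_apply, Finset.sum_eq_add l m h]
  · simp only [rot_apply_right h, if_true, if_neg h.symm, mul_neg]
  · intro k _ hk
    simp [rot_apply_right h, hk.1, hk.2]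
  · simp
  · simp

lemma mul_rot_of_ne {r n : ℕ} {l m j : Fin n} (hl : j ≠ l) (hm : j ≠ m) (θ φ : ℝ)
    (B : Matrix (Fin r) (Fin n) ℂ) (i : Fin r) :
    (B * rot l m θ φ) i j = B i j := by
  simp [Matrix.mul_apply, rot_apply_of_ne hl hm]

lemma rotH_mul_apply {r n : ℕ} (R : Matrix (Fin n) (Fin n) ℂ) (B : Matrix (Fin n) (Fin r) ℂ)
    (i : Fin n) (j : Fin r) : (Rᴴ * B) i j = conj ((Bᴴ * R) j i) := by
  rw [← Matrix.conjTranspose_conjTranspose (Rᴴ * B), Matrix.conjTranspose_mul,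
    Matrix.conjTranspose_conjTranspose, Matrix.conjTranspose_apply]
  rfl

lemma rotH_mul_left {r n : ℕ} {l m : Fin n} (h : l ≠ m) (θ φ : ℝ)
    (B : Matrix (Fin n) (Fin r) ℂ) (j : Fin r) :
    ((rot l m θ φ)ᴴ * B) l j = Real.cos θ * B l j + csin θ φ * B m j := by
  rw [rotH_mul_apply, mul_rot_left h]
  simp [Matrix.conjTranspose_apply, mul_comm, -Complex.ofReal_cos]

lemma rotH_mul_right {r n : ℕ} {l m : Fin n} (h : l ≠ m) (θ φ : ℝ)
    (B : Matrix (Fin n) (Fin r) ℂ) (j : Fin r) :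
    ((rot l m θ φ)ᴴ * B) m j = -conj (csin θ φ) * B l j + Real.cos θ * B m j := by
  rw [rotH_mul_apply, mul_rot_right h]
  simp [Matrix.conjTranspose_apply, mul_comm, -Complex.ofReal_cos]

lemma rotH_mul_of_ne {r n : ℕ} {l m i : Fin n} (hl : i ≠ l) (hm : i ≠ m) (θ φ : ℝ)
    (B : Matrix (Fin n) (Fin r) ℂ) (j : Fin r) :
    ((rot l m θ φ)ᴴ * B) i j = B i j := by
  rw [rotH_mul_apply, mul_rot_of_ne hl hm]
  simp [Matrix.conjTranspose_apply]

lemma csin_mul_conj (θ φ : ℝ) :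
    csin θ φ * conj (csin θ φ) = 1 - (Real.cos θ : ℂ) * (Real.cos θ : ℂ) := by
  rw [Complex.mul_conj, Complex.normSq_eq_norm_sq, norm_csin_sq, Real.sin_sq]
  push_cast; ring

lemma rot_unitary {n : ℕ} {l m : Fin n} (h : l ≠ m) (θ φ : ℝ) :
    (rot l m θ φ)ᴴ * rot l m θ φ = 1 := by
  have hc := csin_mul_conj θ φ
  ext i j
  rcases eq_or_ne i l with rfl | hil
  · rw [rotH_mul_left h]
    rcases eq_or_ne j i with rfl | hjl
    · rw [rot_apply_left h, rot_apply_left h, if_pos rfl, if_neg h.symm, if_pos rfl, hc,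
        Matrix.one_apply_eq]
      ring
    rcases eq_or_ne j m with rfl | hjm
    · rw [rot_apply_right h, rot_apply_right h, if_pos rfl, if_neg h.symm, if_pos rfl,
        Matrix.one_apply_ne h]
      ring
    · rw [rot_apply_of_ne hjl hjm, rot_apply_of_ne hjl hjm, if_neg hjl.symm, if_neg hjm.symm,
        Matrix.one_apply_ne hjl.symm]
      ring
  rcases eq_or_ne i m with rfl | him
  · rw [rotH_mul_right h]
    rcases eq_or_ne j l with rfl | hjl
    · rw [rot_apply_left h, rot_apply_left h, if_pos rfl, if_neg hil, if_pos rfl,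
        Matrix.one_apply_ne hil]
      ring
    rcases eq_or_ne j i with rfl | hjm
    · rw [rot_apply_right h, rot_apply_right h, if_pos rfl, if_neg hil, if_pos rfl,
        Matrix.one_apply_eq]
      linear_combination hc
    · rw [rot_apply_of_ne hjl hjm, rot_apply_of_ne hjl hjm, if_neg hjl.symm, if_neg hjm.symm,
        Matrix.one_apply_ne hjm.symm]
      ring
  · rw [rotH_mul_of_ne hil him, Matrix.one_apply]
    rcases eq_or_ne j l with rfl | hjl
    · rw [rot_apply_left h, if_neg hil, if_neg him, if_neg hil]
    rcases eq_or_ne j m with rfl | hjm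
    · rw [rot_apply_right h, if_neg hil, if_neg him, if_neg him]
    · rw [rot_apply_of_ne hjl hjm]

/-! ### The rotated matrix -/

/-- `Re (e^{-iφ} A_{lm})`. -/
noncomputable def crossRe {n : ℕ} (A : Matrix (Fin n) (Fin n) ℂ) (l m : Fin n) (φ : ℝ) : ℝ :=
  (A l m).re * Real.cos φ + (A l m).im * Real.sin φ

/-- `Im (e^{-iφ} A_{lm})`. -/
noncomputable def crossIm {n : ℕ} (A : Matrix (Fin n) (Fin n) ℂ) (l m : Fin n) (φ : ℝ) : ℝ :=
  -(A l m).re * Real.sin φ + (A l m).im * Real.cos φ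

/-- Half the difference of the diagonal entries `A_{ll}`, `A_{mm}`. -/
noncomputable def halfDiff {n : ℕ} (A : Matrix (Fin n) (Fin n) ℂ) (l m : Fin n) : ℝ :=
  ((A l l).re - (A m m).re) / 2

lemma csin_re (θ φ : ℝ) : (csin θ φ).re = Real.cos φ * Real.sin θ := by
  rw [csin, mul_comm Complex.I, Complex.exp_mul_I, ← Complex.ofReal_cos, ← Complex.ofReal_sin]
  simp [-Complex.ofReal_cos, -Complex.ofReal_sin]

lemma csin_im (θ φ : ℝ) : (csin θ φ).im = Real.sin φ * Real.sin θ := by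
  rw [csin, mul_comm Complex.I, Complex.exp_mul_I, ← Complex.ofReal_cos, ← Complex.ofReal_sin]
  simp [-Complex.ofReal_cos, -Complex.ofReal_sin]

lemma herm_diag_im {n : ℕ} {A : Matrix (Fin n) (Fin n) ℂ} (hA : A.IsHermitian) (i : Fin n) :
    (A i i).im = 0 := Complex.conj_eq_iff_im.1 (hA.apply i i)

lemma herm_re {n : ℕ} {A : Matrix (Fin n) (Fin n) ℂ} (hA : A.IsHermitian) (i j : Fin n) :
    (A j i).re = (A i j).re := by
  rw [← hA.apply j i]; simp

lemma herm_im {n : ℕ} {A : Matrix (Fin n) (Fin n) ℂ} (hA : A.IsHermitian) (i j : Fin n) :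
    (A j i).im = -(A i j).im := by
  rw [← hA.apply j i]; simp

lemma herm_norm {n : ℕ} {A : Matrix (Fin n) (Fin n) ℂ} (hA : A.IsHermitian) (i j : Fin n) :
    ‖A j i‖ = ‖A i j‖ := by
  rw [← hA.apply j i, norm_star]

/-- Multiplying the rotated entry by `e^{-iφ}` splits it into a real part, which θ can cancel, and
an imaginary part independent of θ, which only φ can cancel. -/
lemma pivot_entry_sq {n : ℕ} {A : Matrix (Fin n) (Fin n) ℂ} (hA : A.IsHermitian) {l m : Fin n}
    (h : l ≠ m) (θ φ : ℝ) :
    ‖((rot l m θ φ)ᴴ * A * rot l m θ φ) l m‖ ^ 2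
      = (-halfDiff A l m * Real.sin (2 * θ) + crossRe A l m φ * Real.cos (2 * θ)) ^ 2
        + crossIm A l m φ ^ 2 := by
  rw [mul_rot_right h, rotH_mul_left h, rotH_mul_left h, ← Complex.normSq_eq_norm_sq,
    Complex.normSq_apply]
  simp only [Complex.add_re, Complex.add_im, Complex.neg_re, Complex.neg_im, Complex.mul_re,
    Complex.mul_im, Complex.ofReal_re, Complex.ofReal_im, csin_re, csin_im, herm_diag_im hA,
    herm_re hA l m, herm_im hA l m, Real.sin_two_mul, Real.cos_two_mul', crossRe, crossIm, halfDiff]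
  have h1 := Real.sin_sq_add_cos_sq θ
  have h2 := Real.sin_sq_add_cos_sq φ
  set s := Real.sin θ
  set c := Real.cos θ
  set S := Real.sin φ
  set C := Real.cos φ
  set u := (A l m).re
  set v := (A l m).im
  set a := (A l l).re
  set b := (A m m).re
  set g := -((a - b) / 2) * (2 * s * c) + (u * C + v * S) * (c ^ 2 - s ^ 2)
  set y := -u * S + v * C
  have key : ∀ x y' : ℝ, x = C * g - S * y → y' = S * g + C * y →
      x * x + y' * y' = g ^ 2 + y ^ 2 := by
    rintro _ _ rfl rfl
    linear_combination (g ^ 2 + y ^ 2) * h2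
  refine key _ _ ?_ ?_
  · linear_combination (u * S ^ 2 - C * S * v) * h1 - c ^ 2 * u * h2
  · linear_combination (v * C ^ 2 - C * S * u) * h1 - c ^ 2 * v * h2

lemma S_rotCol {n : ℕ} {A : Matrix (Fin n) (Fin n) ℂ} (hA : A.IsHermitian) {l m : Fin n}
    (h : l ≠ m) (θ φ : ℝ) :
    S A (rotCol l m θ φ) = ((A l l).re + (A m m).re) / 2
      + halfDiff A l m * Real.cos (2 * θ) + crossRe A l m φ * Real.sin (2 * θ) := by
  have : star (rotCol l m θ φ) ⬝ᵥ (A *ᵥ rotCol l m θ φ)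
      = ((rot l m θ φ)ᴴ * A * rot l m θ φ) l l := by
    rw [Matrix.mul_assoc, Matrix.mul_apply]
    rfl
  rw [S, this, mul_rot_left h, rotH_mul_left h, rotH_mul_left h]
  simp only [Complex.add_re, Complex.add_im, Complex.mul_re,
    Complex.mul_im, Complex.ofReal_re, Complex.ofReal_im, Complex.conj_re, Complex.conj_im,
    csin_re, csin_im, herm_diag_im hA,
    herm_re hA l m, herm_im hA l m, Real.sin_two_mul, Real.cos_two_mul', crossRe, halfDiff]
  have h1 := Real.sin_sq_add_cos_sq θ
  have h2 := Real.sin_sq_add_cos_sq φ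
  set s := Real.sin θ
  set c := Real.cos θ
  set S := Real.sin φ
  set C := Real.cos φ
  linear_combination ((A l l).re + (A m m).re) / 2 * h1 + (A m m).re * s ^ 2 * h2

/-! ### Off-diagonal parts and annihilation -/

/-- The squared absolute values of the entries of `B`, extended by zero. -/
noncomputable def ent {n : ℕ} (B : Matrix (Fin n) (Fin n) ℂ) (i j : ℕ) : ℝ :=
  if h : i < n ∧ j < n then ‖B ⟨i, h.1⟩ ⟨j, h.2⟩‖ ^ 2 else 0

lemma ent_coe {n : ℕ} (B : Matrix (Fin n) (Fin n) ℂ) (i j : Fin n) :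
    ent B i j = ‖B i j‖ ^ 2 := by simp [ent]

/-- A Hermitian matrix with zero diagonal. -/
structure HermOff {n : ℕ} (B : Matrix (Fin n) (Fin n) ℂ) : Prop where
  herm : B.IsHermitian
  diag : ∀ i, B i i = 0

lemma HermOff.sub {n : ℕ} {A B : Matrix (Fin n) (Fin n) ℂ} (hA : HermOff A) (hB : HermOff B) :
    HermOff (A - B) :=
  ⟨hA.herm.sub hB.herm, fun i => by simp [hA.diag, hB.diag]⟩

lemma HermOff.symmEnt {n : ℕ} {B : Matrix (Fin n) (Fin n) ℂ} (hB : HermOff B) :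
    SymmEnt (ent B) where
  nonneg i j := by unfold ent; split_ifs <;> positivity
  symm i j := by
    unfold ent
    by_cases h : i < n ∧ j < n
    · rw [dif_pos h, dif_pos h.symm, herm_norm hB.herm]
    · rw [dif_neg h, dif_neg fun h' => h h'.symm]
  diag i := by
    unfold ent
    split_ifs
    · simp [hB.diag]
    · rfl

/-- The change of the off-diagonal entries under a rotation in the `(l, m)` plane, with nothing
said about the entry `(l, m)`. -/
structure OffStep {n : ℕ} (c : ℝ) (s : ℂ) (l m : Fin n) (B B' : Matrix (Fin n) (Fin n) ℂ) :
    Prop where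
  row_left : ∀ j, j ≠ l → j ≠ m → B' l j = c * B l j + s * B m j
  row_right : ∀ j, j ≠ l → j ≠ m → B' m j = -conj s * B l j + c * B m j
  same : ∀ i j, i ≠ l → i ≠ m → j ≠ l → j ≠ m → B' i j = B i j

lemma OffStep.sub {n : ℕ} {c : ℝ} {s : ℂ} {l m : Fin n} {A A' B B' : Matrix (Fin n) (Fin n) ℂ}
    (hA : OffStep c s l m A A') (hB : OffStep c s l m B B') :
    OffStep c s l m (A - B) (A' - B') where
  row_left j h1 h2 := by
    simp only [Matrix.sub_apply, hA.row_left j h1 h2, hB.row_left j h1 h2]; ring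
  row_right j h1 h2 := by
    simp only [Matrix.sub_apply, hA.row_right j h1 h2, hB.row_right j h1 h2]; ring
  same i j h1 h2 h3 h4 := by
    simp only [Matrix.sub_apply, hA.same i j h1 h2 h3 h4, hB.same i j h1 h2 h3 h4]

lemma norm_sq_rotation {c : ℝ} {s : ℂ} (h : c ^ 2 + ‖s‖ ^ 2 = 1) (x y : ℂ) :
    ‖c * x + s * y‖ ^ 2 + ‖-conj s * x + c * y‖ ^ 2 = ‖x‖ ^ 2 + ‖y‖ ^ 2 := by
  simp only [← Complex.normSq_eq_norm_sq, Complex.normSq_apply, Complex.add_re, Complex.add_im,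
    Complex.mul_re, Complex.mul_im, Complex.ofReal_re, Complex.ofReal_im, Complex.neg_re,
    Complex.neg_im, Complex.conj_re, Complex.conj_im] at h ⊢
  linear_combination (x.re ^ 2 + x.im ^ 2 + y.re ^ 2 + y.im ^ 2) * h

lemma OffStep.entStep {n : ℕ} {c : ℝ} {s : ℂ} {l m : Fin n} {B B' : Matrix (Fin n) (Fin n) ℂ}
    (hB : OffStep c s l m B B') (h : c ^ 2 + ‖s‖ ^ 2 = 1) : EntStep l m (ent B) (ent B') where
  pair j hl hm := by
    by_cases hj : j < n
    · lift j to Fin n using hj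
      rw [Ne, Fin.val_inj] at hl hm
      simp only [ent_coe, hB.row_left j hl hm, hB.row_right j hl hm]
      exact norm_sq_rotation h _ _
    · simp [ent, hj]
  same i j hil him hjl hjm := by
    by_cases hij : i < n ∧ j < n
    · obtain ⟨hi, hj⟩ := hij
      lift i to Fin n using hi
      lift j to Fin n using hj
      rw [Ne, Fin.val_inj] at hil him hjl hjm
      rw [ent_coe, ent_coe, hB.same i j hil him hjl hjm]
    · rw [ent, dif_neg hij, ent, dif_neg hij]

/-- The inequality `mix` is a weighted Cauchy–Schwarz inequality for `c x + s y` with weights `1`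
and `1 - K`; the resulting factor is `(1 - K)c² + |s|² = 1 - c²K`. -/
lemma OffStep.annihStep {n : ℕ} {c : ℝ} {s : ℂ} {l m : Fin n} {B B' : Matrix (Fin n) (Fin n) ℂ}
    (hB : OffStep c s l m B B') (h : c ^ 2 + ‖s‖ ^ 2 = 1) (h0 : B' l m = 0) {κ : ℝ}
    (hκ : κ ≤ c ^ 2) : AnnihStep κ l m (ent B) (ent B') where
  toEntStep := hB.entStep h
  zero := by simp [ent_coe, h0]
  mix K hK0 hK1 j hl hm := by
    by_cases hj : j < n
    · lift j to Fin n using hj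
      rw [Ne, Fin.val_inj] at hl hm
      simp only [ent_coe, hB.row_left j hl hm]
      have h1 : ‖c * B l j + s * B m j‖ ^ 2 ≤ (|c| * ‖B l j‖ + ‖s‖ * ‖B m j‖) ^ 2 := by
        gcongr
        refine (norm_add_le _ _).trans_eq ?_
        rw [norm_mul, norm_mul, Complex.norm_real, Real.norm_eq_abs]
      rw [← sq_abs] at h hκ
      have hsum : 0 ≤ ‖B l j‖ ^ 2 + (1 - K) * ‖B m j‖ ^ 2 := by
        have := sub_nonneg.2 hK1
        positivity
      calc _ ≤ (1 - K) * (|c| * ‖B l j‖ + ‖s‖ * ‖B m j‖) ^ 2 :=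
            mul_le_mul_of_nonneg_left h1 (sub_nonneg.2 hK1)
        _ ≤ (1 - |c| ^ 2 * K) * (‖B l j‖ ^ 2 + (1 - K) * ‖B m j‖ ^ 2) := by
            have h2 := sq_nonneg (‖s‖ * ‖B l j‖ - (1 - K) * |c| * ‖B m j‖)
            have hs : ‖s‖ ^ 2 = 1 - |c| ^ 2 := by linarith
            refine le_of_sub_nonneg (h2.trans_eq ?_)
            linear_combination (‖B l j‖ ^ 2 + (1 - K) * ‖B m j‖ ^ 2) * hs
        _ ≤ _ := by
            refine mul_le_mul_of_nonneg_right ?_ hsum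
            nlinarith
    · simp [ent, hj]
  mix_zero j hl hm hz := by
    by_cases hj : j < n
    · lift j to Fin n using hj
      rw [Ne, Fin.val_inj] at hl hm
      rw [ent_coe] at hz
      have hz' : B l j = 0 := by simpa using hz
      rw [ent_coe, ent_coe, hB.row_left j hl hm, hz', mul_zero, zero_add, norm_mul, mul_pow]
      exact mul_le_mul_of_nonneg_right (by linarith) (sq_nonneg _)
    · simp [ent, hj]

/-- The off-diagonal part of a matrix. -/
def offDiag {n : ℕ} (A : Matrix (Fin n) (Fin n) ℂ) : Matrix (Fin n) (Fin n) ℂ :=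
  Matrix.of fun i j => if i = j then 0 else A i j

lemma offDiag_of_ne {n : ℕ} (A : Matrix (Fin n) (Fin n) ℂ) {i j : Fin n} (h : i ≠ j) :
    offDiag A i j = A i j := by simp [offDiag, h]

lemma hermOff_offDiag {n : ℕ} {A : Matrix (Fin n) (Fin n) ℂ} (hA : A.IsHermitian) :
    HermOff (offDiag A) where
  herm := Matrix.IsHermitian.ext fun i j => by
    rcases eq_or_ne i j with rfl | h
    · simp [offDiag]
    · rw [offDiag_of_ne _ h, offDiag_of_ne _ h.symm, hA.apply]
  diag i := by simp [offDiag]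

/-- A matrix with the entries `(l, m)` and `(m, l)` set to zero. -/
def annihilate {n : ℕ} (l m : Fin n) (A : Matrix (Fin n) (Fin n) ℂ) : Matrix (Fin n) (Fin n) ℂ :=
  Matrix.of fun i j => if (i = l ∧ j = m) ∨ (i = m ∧ j = l) then 0 else A i j

lemma HermOff.annihilate {n : ℕ} {A : Matrix (Fin n) (Fin n) ℂ} (hA : HermOff A) (l m : Fin n) :
    HermOff (annihilate l m A) where
  herm := Matrix.IsHermitian.ext fun i j => by
    have := hA.herm.apply i j
    simp only [OBNSLA.annihilate, Matrix.of_apply]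
    by_cases h : (i = l ∧ j = m) ∨ (i = m ∧ j = l)
    · rw [if_pos h, if_pos (by tauto), star_zero]
    · rw [if_neg h, if_neg (by tauto), this]
  diag i := by
    simp only [OBNSLA.annihilate, Matrix.of_apply]
    split_ifs
    · rfl
    · exact hA.diag i

/-- Diagonal entries influence, off the diagonal, only the new pivot. They can therefore be
discarded before and after the rotation, and the new pivot may be prescribed freely. -/
lemma offStep_of_eq {n : ℕ} {l m : Fin n} (h : l ≠ m) (θ φ : ℝ)
    {A B B' : Matrix (Fin n) (Fin n) ℂ} (hB : HermOff B) (hB' : HermOff B')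
    (hAB : ∀ i j, i ≠ j → B i j = A i j)
    (hAB' : ∀ i j, i ≠ j → (j ≠ l ∧ j ≠ m) →
      B' i j = ((rot l m θ φ)ᴴ * A * rot l m θ φ) i j) :
    OffStep (Real.cos θ) (csin θ φ) l m B B' := by
  constructor
  · intro j h1 h2
    rw [hAB' _ _ h1.symm ⟨h1, h2⟩, mul_rot_of_ne h1 h2, rotH_mul_left h, hAB _ _ h1.symm,
      hAB _ _ h2.symm]
  · intro j h1 h2
    rw [hAB' _ _ h2.symm ⟨h1, h2⟩, mul_rot_of_ne h1 h2, rotH_mul_right h, hAB _ _ h1.symm,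
      hAB _ _ h2.symm]
  · intro i j h1 h2 h3 h4
    rcases eq_or_ne i j with rfl | hij
    · rw [hB.diag, hB'.diag]
    · rw [hAB' _ _ hij ⟨h3, h4⟩, mul_rot_of_ne h3 h4, rotH_mul_of_ne h1 h2, hAB _ _ hij]

lemma blockSum_offDiag {n : ℕ} {A : Matrix (Fin n) (Fin n) ℂ} (hA : A.IsHermitian) :
    blockSum 0 n (ent (offDiag A)) = 2 * offNorm A ^ 2 := by
  have h1 : blockSum 0 n (ent (offDiag A)) = ∑ j, ∑ i, ‖offDiag A i j‖ ^ 2 := by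
    rw [blockSum, Nat.Ico_zero_eq_range, Finset.sum_range]
    refine Finset.sum_congr rfl fun j _ => ?_
    rw [Finset.sum_range]
    exact Finset.sum_congr rfl fun i _ => ent_coe _ _ _
  have h2 : ∀ i j, ‖offDiag A i j‖ ^ 2
      = ‖if i < j then A i j else 0‖ ^ 2 + ‖if j < i then A j i else 0‖ ^ 2 := by
    intro i j
    rcases lt_trichotomy i j with h | rfl | h
    · simp [offDiag_of_ne _ h.ne, h, h.asymm]
    · simp [offDiag]
    · simp [offDiag_of_ne _ h.ne', h, h.asymm, herm_norm hA i j]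
  rw [h1, offNorm, frobenius_sq]
  simp only [h2, Finset.sum_add_distrib, Matrix.of_apply]
  rw [Finset.sum_comm, two_mul]

lemma two_mul_offNorm_sq_le {n : ℕ} {A : Matrix (Fin n) (Fin n) ℂ} (hA : A.IsHermitian) :
    2 * offNorm A ^ 2 ≤ ‖A‖ ^ 2 := by
  rw [frobenius_sq, Finset.sum_comm, ← blockSum_offDiag hA, blockSum, Nat.Ico_zero_eq_range,
    Finset.sum_range]
  refine Finset.sum_le_sum fun j _ => ?_
  rw [Finset.sum_range]
  refine Finset.sum_le_sum fun i _ => ?_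
  rw [ent_coe]
  rcases eq_or_ne i j with rfl | h
  · simp [offDiag]
  · rw [offDiag_of_ne _ h]

/-! ### Jacobi sweeps with inexact annihilation -/

/-- Cyclic Jacobi rotations of a Hermitian matrix with `cos² ≥ κ` after which the entry at the
pivot is at most `√ε`. -/
structure ApproxJacobi {n : ℕ} (hn : 2 ≤ n) (κ ε : ℝ) (θ φ : ℕ → ℝ)
    (A : ℕ → Matrix (Fin n) (Fin n) ℂ) : Prop where
  herm : ∀ k, (A k).IsHermitian
  step : ∀ k, A (k + 1) = (rot (pivot n hn k).1 (pivot n hn k).2 (θ k) (φ k))ᴴ * A k *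
    rot (pivot n hn k).1 (pivot n hn k).2 (θ k) (φ k)
  cos_sq : ∀ k, κ ≤ Real.cos (θ k) ^ 2
  pivot_entry : ∀ k, ‖A (k + 1) (pivot n hn k).1 (pivot n hn k).2‖ ^ 2 ≤ ε

lemma cos_sq_add_csin (θ φ : ℝ) : Real.cos θ ^ 2 + ‖csin θ φ‖ ^ 2 = 1 := by
  rw [norm_csin_sq, Real.cos_sq_add_sin_sq]

section

variable {n : ℕ} {hn : 2 ≤ n} {κ ε : ℝ} {θ φ : ℕ → ℝ} {A : ℕ → Matrix (Fin n) (Fin n) ℂ}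

lemma ApproxJacobi.offStep (hA : ApproxJacobi hn κ ε θ φ A) (k : ℕ) :
    OffStep (Real.cos (θ k)) (csin (θ k) (φ k)) (pivot n hn k).1 (pivot n hn k).2
      (offDiag (A k)) (offDiag (A (k + 1))) :=
  offStep_of_eq (pivot_lt hn k).ne _ _ (A := A k) (hermOff_offDiag (hA.herm _))
    (hermOff_offDiag (hA.herm _)) (fun _ _ h => offDiag_of_ne _ h)
    fun _ _ h _ => by rw [offDiag_of_ne _ h, hA.step]

lemma ApproxJacobi.pivot_ent (hA : ApproxJacobi hn κ ε θ φ A) (k : ℕ) :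
    ent (offDiag (A (k + 1))) (pivot n hn k).1 (pivot n hn k).2 ≤ ε := by
  rw [ent_coe, offDiag_of_ne _ (pivot_lt hn k).ne]
  exact hA.pivot_entry k

lemma ApproxJacobi.offNorm_sq_le (hA : ApproxJacobi hn κ ε θ φ A) (k i : ℕ) :
    offNorm (A (k + i)) ^ 2 ≤ offNorm (A k) ^ 2 + i * ε := by
  induction i with
  | zero => simp
  | succ i ih =>
    have h := ((hA.offStep (k + i)).entStep (cos_sq_add_csin _ _)).blockSum_eq (b := 0) (n := n)
      (hermOff_offDiag (hA.herm _)).symmEnt (hermOff_offDiag (hA.herm _)).symmEnt (Nat.zero_le _)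
      (pivot_lt hn _) (Fin.is_lt _)
    rw [blockSum_offDiag (hA.herm _), blockSum_offDiag (hA.herm _)] at h
    have h1 := hA.pivot_ent (k + i)
    have h2 := (hermOff_offDiag (hA.herm (k + i))).symmEnt.nonneg
      (pivot n hn (k + i)).1 (pivot n hn (k + i)).2
    rw [← add_assoc]
    push_cast
    linarith

/-- The off-diagonal part of `A` under the rotations from time `k` on, if the pivot is annihilated
after each rotation. -/
noncomputable def annihProcess (hn : 2 ≤ n) (θ φ : ℕ → ℝ) (k : ℕ) (B : Matrix (Fin n) (Fin n) ℂ) :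
    ℕ → Matrix (Fin n) (Fin n) ℂ
  | 0 => B
  | t + 1 => annihilate (pivot n hn (k + t)).1 (pivot n hn (k + t)).2 (offDiag
      ((rot (pivot n hn (k + t)).1 (pivot n hn (k + t)).2 (θ (k + t)) (φ (k + t)))ᴴ *
        annihProcess hn θ φ k B t *
        rot (pivot n hn (k + t)).1 (pivot n hn (k + t)).2 (θ (k + t)) (φ (k + t))))

lemma hermOff_annihProcess {B : Matrix (Fin n) (Fin n) ℂ} (hB : HermOff B) (k t : ℕ) :
    HermOff (annihProcess hn θ φ k B t) := by
  induction t with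
  | zero => exact hB
  | succ t ih =>
    exact (hermOff_offDiag (Matrix.isHermitian_conjTranspose_mul_mul _ ih.herm)).annihilate _ _

lemma offStep_annihProcess {B : Matrix (Fin n) (Fin n) ℂ} (hB : HermOff B) (k t : ℕ) :
    OffStep (Real.cos (θ (k + t))) (csin (θ (k + t)) (φ (k + t))) (pivot n hn (k + t)).1
      (pivot n hn (k + t)).2 (annihProcess hn θ φ k B t) (annihProcess hn θ φ k B (t + 1)) := by
  refine offStep_of_eq (pivot_lt hn _).ne _ _ (hermOff_annihProcess hB k t)
    (hermOff_annihProcess hB k (t + 1)) (fun _ _ _ => rfl) fun i j h hj => ?_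
  rw [annihProcess, annihilate, Matrix.of_apply, if_neg (by tauto), offDiag_of_ne _ h]

lemma annihProcess_pivot (B : Matrix (Fin n) (Fin n) ℂ) (k t : ℕ) :
    annihProcess hn θ φ k B (t + 1) (pivot n hn (k + t)).1 (pivot n hn (k + t)).2 = 0 := by
  simp [annihProcess, annihilate]

/-- The effect of a sweep on the sum of the squares above the diagonal. -/
theorem ApproxJacobi.sweep (hA : ApproxJacobi hn κ ε θ φ A) (hκ0 : 0 ≤ κ) {k : ℕ}
    (hk : PivotAt hn k 0 1) :
    offNorm (A (k + sweepLength (n - 1))) ^ 2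
      ≤ (1 - κ ^ sweepExp (n - 1) / 2) * offNorm (A k) ^ 2 + 2 * (sweepLength (n - 1) * ε) := by
  have hκ1 : κ ≤ 1 := (hA.cos_sq 0).trans (Real.cos_sq_le_one _)
  set v : ℕ → Matrix (Fin n) (Fin n) ℂ := fun t => offDiag (A (k + t)) with hv
  set w := annihProcess hn θ φ k (v 0) with hw
  have hvH : ∀ t, HermOff (v t) := fun t => hermOff_offDiag (hA.herm _)
  have hwH : ∀ t, HermOff (w t) := hermOff_annihProcess (hvH 0) k
  have hvS : ∀ t, OffStep (Real.cos (θ (k + t))) (csin (θ (k + t)) (φ (k + t)))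
      (pivot n hn (k + t)).1 (pivot n hn (k + t)).2 (v t) (v (t + 1)) := fun t =>
    hA.offStep (k + t)
  have hwS := offStep_annihProcess (hn := hn) (θ := θ) (φ := φ) (hvH 0) k
  -- For old pivots `x`, `y` of `v`, `w` and new pivot `z` of `v`, the left side changes by `-2|x|²
  -- + |y|² - 2|x-y|² + 4|z|²`. The first three terms have nonpositive sum by `hpar`, and `|z|² ≤
  -- ε`.
  have hpot : ∀ t, blockSum 0 n (ent (v t)) - blockSum 0 n (ent (w t)) / 2
      + blockSum 0 n (ent (v t - w t)) ≤ blockSum 0 n (ent (v 0)) / 2 + 4 * (t * ε) := by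
    intro t
    induction t with
    | zero =>
      have : w 0 = v 0 := rfl
      have h0 : blockSum 0 n (ent (0 : Matrix (Fin n) (Fin n) ℂ)) = 0 := by
        simp [blockSum, ent]
      rw [this, sub_self, h0]
      simp
    | succ t ih =>
      have hlm := pivot_lt hn (k + t)
      have e1 := ((hvS t).entStep (cos_sq_add_csin _ _)).blockSum_eq (b := 0) (n := n)
        (hvH _).symmEnt (hvH _).symmEnt (Nat.zero_le _) hlm (Fin.is_lt _)
      have e2 := ((hwS t).entStep (cos_sq_add_csin _ _)).blockSum_eq (b := 0) (n := n)
        (hwH _).symmEnt (hwH _).symmEnt (Nat.zero_le _) hlm (Fin.is_lt _)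
      have e3 := (((hvS t).sub (hwS t)).entStep (cos_sq_add_csin _ _)).blockSum_eq (b := 0)
        (n := n) ((hvH _).sub (hwH _)).symmEnt ((hvH _).sub (hwH _)).symmEnt (Nat.zero_le _) hlm
        (Fin.is_lt _)
      have hε := hA.pivot_ent (k + t)
      have hw0 := annihProcess_pivot (hn := hn) (θ := θ) (φ := φ) (v 0) k t
      change ent (v (t + 1)) _ _ ≤ ε at hε
      rw [ent_coe] at hε
      simp only [ent_coe, Matrix.sub_apply, hw0, sub_zero, norm_zero] at e1 e2 e3
      have hpar : ∀ x y : ℂ, ‖y‖ ^ 2 ≤ 2 * ‖x‖ ^ 2 + 2 * ‖x - y‖ ^ 2 := by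
        intro x y
        have h1 : ‖y‖ ≤ ‖x‖ + ‖x - y‖ := by
          calc ‖y‖ = ‖x - (x - y)‖ := by rw [sub_sub_cancel]
            _ ≤ _ := norm_sub_le _ _
        nlinarith [norm_nonneg y, sq_nonneg (‖x‖ - ‖x - y‖)]
      have h2 := hpar (v t (pivot n hn (k + t)).1 (pivot n hn (k + t)).2)
        (w t (pivot n hn (k + t)).1 (pivot n hn (k + t)).2)
      push_cast
      rw [← hw] at e2 e3
      linarith
  have hsc := (sweep_contraction hκ0 hκ1 hn (fun t => ent (w t)) (fun t => (hwH t).symmEnt) k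
    (fun t => (hwS t).annihStep (cos_sq_add_csin _ _) (annihProcess_pivot _ _ _)
      (hA.cos_sq _)) (n - 1) 0 0 (by omega) fun _ => hk).1
  have hp := hpot (sweepLength (n - 1))
  have hd := blockSum_nonneg ((hvH (sweepLength (n - 1))).sub (hwH (sweepLength (n - 1)))).symmEnt
    0 n
  rw [zero_add, show w 0 = v 0 from rfl] at hsc
  simp only [hv, blockSum_offDiag (hA.herm _), add_zero] at hsc hp hd
  linarith

lemma pivotAt_mul_sweepLength (hn : 2 ≤ n) (j : ℕ) :
    PivotAt hn (j * sweepLength (n - 1)) 0 1 := by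
  induction j with
  | zero => rw [zero_mul]; exact pivotAt_zero hn
  | succ j ih =>
    have := pivotAt_sweep (n - 2) (by omega) ih
    rwa [show n - 2 + 1 = n - 1 by omega, ← Nat.succ_mul] at this

/-- The recursion `x ↦ (1 - c/2)x + 2Tε` of a sweep contracts to its fixed point `4Tε/c`. The extra
`Tε` covers the times inside a sweep, where each rotation adds at most `ε`. -/
theorem ApproxJacobi.eventually_le (hA : ApproxJacobi hn κ ε θ φ A) (hκ0 : 0 < κ) (hε : 0 ≤ ε)
    {δ : ℝ} (hδ : 0 < δ) :
    ∀ᶠ k in atTop, offNorm (A k) ^ 2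
      ≤ (4 / κ ^ sweepExp (n - 1) + 1) * (sweepLength (n - 1) * ε) + δ := by
  have hκ1 : κ ≤ 1 := (hA.cos_sq 0).trans (Real.cos_sq_le_one _)
  set T := sweepLength (n - 1) with hT
  set c := κ ^ sweepExp (n - 1) with hc
  have hc0 : 0 < c := pow_pos hκ0 _
  have hc1 : c ≤ 1 := pow_le_one₀ hκ0.le hκ1
  have hTpos : 0 < T := by
    rw [hT, show n - 1 = n - 2 + 1 by omega, sweepLength_succ]; omega
  have hsw : ∀ j, offNorm (A (j * T)) ^ 2
      ≤ 4 / c * (T * ε) + (1 - c / 2) ^ j * offNorm (A 0) ^ 2 := by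
    intro j
    induction j with
    | zero =>
      have : 0 ≤ 4 / c * (T * ε) := by positivity
      simpa using this
    | succ j ih =>
      have h := hA.sweep hκ0.le (pivotAt_mul_sweepLength hn j)
      rw [← hT, ← hc] at h
      rw [Nat.succ_mul]
      have h2 := mul_le_mul_of_nonneg_left ih (by linarith : 0 ≤ 1 - c / 2)
      have h3 : (1 - c / 2) * (4 / c * (T * ε)) + 2 * (T * ε) = 4 / c * (T * ε) := by
        field_simp; ring
      rw [pow_succ (1 - c / 2) j]
      linarith
  have htend : Tendsto (fun k : ℕ => (1 - c / 2) ^ (k / T) * offNorm (A 0) ^ 2) atTop (nhds 0) := by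
    have h1 := (tendsto_pow_atTop_nhds_zero_of_lt_one (r := 1 - c / 2) (by linarith)
      (by linarith)).comp (Nat.tendsto_div_const_atTop hTpos.ne')
    simpa using h1.mul_const (offNorm (A 0) ^ 2)
  filter_upwards [htend.eventually_lt_const hδ] with k hk
  have h1 := hA.offNorm_sq_le (k / T * T) (k % T)
  rw [Nat.div_add_mod'] at h1
  have h2 : ((k % T : ℕ) : ℝ) * ε ≤ T * ε :=
    mul_le_mul_of_nonneg_right (by exact_mod_cast (Nat.mod_lt k hTpos).le) hε
  linarith [hsw (k / T)]

end

/-! ### Critical points of trigonometric functions -/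

/-- The derivative of `p cos + q sin`. -/
noncomputable def trigDeriv (p q t : ℝ) : ℝ := -p * Real.sin t + q * Real.cos t

/-- The derivative is a sinusoid of amplitude `√(p² + q²)` vanishing at `t₀`, and `|sin u| ≤ |u|`.
-/
lemma trigDeriv_sq_le {p q t t₀ : ℝ} (h : trigDeriv p q t₀ = 0) :
    trigDeriv p q t ^ 2 ≤ (p ^ 2 + q ^ 2) * (t - t₀) ^ 2 := by
  have h1 : trigDeriv p q t = Real.cos (t - t₀) * trigDeriv p q t₀
      - Real.sin (t - t₀) * (p * Real.cos t₀ + q * Real.sin t₀) := by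
    conv_lhs => rw [show t = t₀ + (t - t₀) by ring]
    rw [trigDeriv, trigDeriv, Real.sin_add, Real.cos_add]
    ring
  have h2 : (p * Real.cos t₀ + q * Real.sin t₀) ^ 2 ≤ p ^ 2 + q ^ 2 := by
    have : (p * Real.cos t₀ + q * Real.sin t₀) ^ 2 + trigDeriv p q t₀ ^ 2 = p ^ 2 + q ^ 2 := by
      rw [trigDeriv]
      linear_combination (p ^ 2 + q ^ 2) * Real.sin_sq_add_cos_sq t₀
    nlinarith [sq_nonneg (trigDeriv p q t₀)]
  have h3 : Real.sin (t - t₀) ^ 2 ≤ (t - t₀) ^ 2 := sq_le_sq.2 Real.abs_sin_le_abs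
  rw [h1, h, mul_zero, zero_sub, neg_sq, mul_pow, mul_comm]
  exact mul_le_mul h2 h3 (sq_nonneg _) (by positivity)

lemma trigDeriv_eq_zero_of_isArgmin {C p q ω L t₀ : ℝ} (hω : 0 < ω) (hL : ω * L = Real.pi)
    (h : IsArgmin (fun t => C + p * Real.cos (ω * t) + q * Real.sin (ω * t)) (Icc (-L) L) t₀) :
    trigDeriv p q (ω * t₀) = 0 := by
  set f : ℝ → ℝ := fun t => C + p * Real.cos (ω * t) + q * Real.sin (ω * t) with hf
  have hL0 : 0 < L := pos_of_mul_pos_right (hL ▸ Real.pi_pos) hω.le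
  have hper : Function.Periodic f (2 * L) := fun t => by
    have : ω * (t + 2 * L) = ω * t + 2 * Real.pi := by rw [← hL]; ring
    simp only [hf, this, Real.cos_add_two_pi, Real.sin_add_two_pi]
  have hmin : IsLocalMin f t₀ := Filter.Eventually.of_forall fun y => by
    obtain ⟨y', hy', he⟩ := hper.exists_mem_Ico (by positivity) y (-L)
    rw [he]
    exact h.2 y' ⟨hy'.1, by linarith [hy'.2]⟩
  have hω' : HasDerivAt (fun t : ℝ => ω * t) ω t₀ := by
    simpa using (hasDerivAt_id t₀).const_mul ω
  have hd : HasDerivAt f (p * (-Real.sin (ω * t₀) * ω) + q * (Real.cos (ω * t₀) * ω)) t₀ :=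
    ((hω'.cos.const_mul p).const_add C).add (hω'.sin.const_mul q)
  have h0 := hmin.hasDerivAt_eq_zero hd
  have : ω * trigDeriv p q (ω * t₀) = 0 := by rw [trigDeriv]; linarith
  exact (mul_eq_zero.1 this).resolve_left hω.ne'

lemma trigDeriv_add_pi (p q t : ℝ) : trigDeriv p q (t + Real.pi) = -trigDeriv p q t := by
  simp only [trigDeriv, Real.sin_add_pi, Real.cos_add_pi]; ring

lemma trigDeriv_sub_pi (p q t : ℝ) : trigDeriv p q (t - Real.pi) = -trigDeriv p q t := by
  simp only [trigDeriv, Real.sin_sub_pi, Real.cos_sub_pi]; ring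

lemma wrap_eq (t : ℝ) : wrap t = t ∨ wrap t = t - Real.pi / 2 ∨ wrap t = t + Real.pi / 2 := by
  unfold wrap sgn
  split_ifs
  · exact Or.inl rfl
  · exact Or.inr (Or.inl (by ring))
  · exact Or.inr (Or.inr (by ring))

/-- The reduction moves `2t` by `0` or `±π`, which at most changes the sign of the derivative. It
may turn a minimum into a maximum, but criticality survives. -/
lemma trigDeriv_wrap {p q t t₀ : ℝ} (h : trigDeriv p q (2 * t₀) = 0) :
    trigDeriv p q (2 * (t₀ + (wrap t - t))) = 0 := by
  rcases wrap_eq t with e | e | e <;> rw [e]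
  · simpa using h
  · rw [show 2 * (t₀ + (t - Real.pi / 2 - t)) = 2 * t₀ - Real.pi by ring, trigDeriv_sub_pi, h,
      neg_zero]
  · rw [show 2 * (t₀ + (t + Real.pi / 2 - t)) = 2 * t₀ + Real.pi by ring, trigDeriv_add_pi, h,
      neg_zero]

lemma abs_wrap_le {t : ℝ} (h : |t| ≤ 3 * Real.pi / 4) : |wrap t| ≤ Real.pi / 4 := by
  have hpi := Real.pi_pos
  rw [abs_le] at h ⊢
  unfold wrap sgn
  split_ifs with h1 h2
  · exact h1
  · have : Real.pi / 4 < t := by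
      by_contra h3
      exact h1 ⟨by linarith, by linarith⟩
    constructor <;> linarith
  · have : t < -(Real.pi / 4) := by
      by_contra h3
      exact h1 ⟨by linarith, by linarith⟩
    constructor <;> linarith

lemma cos_sq_ge {θ θ' η : ℝ} (h' : |θ'| ≤ Real.pi / 4) (h : |θ - θ'| ≤ η) :
    (1 - 2 * η) / 2 ≤ Real.cos θ ^ 2 := by
  rw [abs_le] at h'
  have h0 : 0 ≤ Real.cos (2 * θ') :=
    Real.cos_nonneg_of_neg_pi_div_two_le_of_le (by linarith) (by linarith)
  have h1 : |Real.cos (2 * θ) - Real.cos (2 * θ')| ≤ 2 * η := by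
    refine (Real.abs_cos_sub_cos_le _ _).trans ?_
    rw [← mul_sub, abs_mul, abs_two]
    linarith
  rw [Real.cos_sq]
  linarith [(abs_le.1 h1).1]

/-! ### One rotation with approximate angles -/

/-- The angles of one rotation are within `η` of critical angles, and `cos² θ ≥ (1 - 2η)/2`. -/
structure ApproxAngles {n : ℕ} (η : ℝ) (A : Matrix (Fin n) (Fin n) ℂ) (l m : Fin n) (θ φ : ℝ) :
    Prop where
  phi : ∃ φ', crossIm A l m φ' = 0 ∧ |φ - φ'| ≤ η
  theta : ∃ θ', trigDeriv (halfDiff A l m) (crossRe A l m φ) (2 * θ') = 0 ∧ |θ - θ'| ≤ η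
  cos_sq : (1 - 2 * η) / 2 ≤ Real.cos θ ^ 2

lemma ApproxAngles.pivot_entry_le {n : ℕ} {η : ℝ} {A : Matrix (Fin n) (Fin n) ℂ}
    (hA : A.IsHermitian) {l m : Fin n} (hlm : l ≠ m) {θ φ : ℝ} (h : ApproxAngles η A l m θ φ) :
    ‖((rot l m θ φ)ᴴ * A * rot l m θ φ) l m‖ ^ 2 ≤ 5 / 2 * η ^ 2 * ‖A‖ ^ 2 := by
  obtain ⟨φ', hφ, hφη⟩ := h.phi
  obtain ⟨θ', hθ, hθη⟩ := h.theta
  have h1 : crossIm A l m φ ^ 2 ≤ ‖A l m‖ ^ 2 * η ^ 2 := by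
    have := trigDeriv_sq_le (t := φ) hφ
    rw [← Complex.normSq_eq_norm_sq, Complex.normSq_apply, ← sq, ← sq]
    refine this.trans (mul_le_mul_of_nonneg_left ?_ (by positivity))
    exact sq_le_sq.2 (hφη.trans (le_abs_self _))
  have hx : crossRe A l m φ ^ 2 ≤ ‖A l m‖ ^ 2 := by
    rw [← Complex.normSq_eq_norm_sq, Complex.normSq_apply, crossRe]
    nlinarith [sq_nonneg ((A l m).re * Real.sin φ - (A l m).im * Real.cos φ),
      Real.sin_sq_add_cos_sq φ]
  have h2 : trigDeriv (halfDiff A l m) (crossRe A l m φ) (2 * θ) ^ 2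
      ≤ (halfDiff A l m ^ 2 + ‖A l m‖ ^ 2) * (4 * η ^ 2) := by
    refine (trigDeriv_sq_le hθ).trans ?_
    have : (2 * θ - 2 * θ') ^ 2 ≤ 4 * η ^ 2 := by
      have := sq_le_sq.2 (hθη.trans (le_abs_self _))
      nlinarith
    exact mul_le_mul (by linarith) this (sq_nonneg _) (by positivity)
  have hfour := sum_four_le_frobenius_sq A hlm
  rw [herm_norm hA l m] at hfour
  have hre : ∀ i, (A i i).re ^ 2 ≤ ‖A i i‖ ^ 2 := fun i =>
    sq_le_sq.2 ((Complex.abs_re_le_norm _).trans (le_abs_self _))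
  have hd : halfDiff A l m ^ 2 ≤ (‖A l l‖ ^ 2 + ‖A m m‖ ^ 2) / 2 := by
    rw [halfDiff]
    nlinarith [hre l, hre m, sq_nonneg ((A l l).re + (A m m).re)]
  rw [pivot_entry_sq hA hlm]
  rw [trigDeriv] at h2
  -- The two parts add up to `η²(5|A_lm|² + 4d²)` with `4d² ≤ 2(|A_ll|² + |A_mm|²)`. Since `A_lm` is
  -- counted twice in `‖A‖²`, the factor `5/2` suffices.
  have hη := sq_nonneg η
  nlinarith [mul_le_mul_of_nonneg_left hd hη, mul_le_mul_of_nonneg_left hfour hη,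
    mul_nonneg hη (sq_nonneg ‖A l l‖), mul_nonneg hη (sq_nonneg ‖A m m‖),
    mul_nonneg hη (sq_nonneg ‖A l m‖)]

lemma W_unitary {n : ℕ} (hn : 2 ≤ n) (θ φ : ℕ → ℝ) (k : ℕ) : (W hn θ φ k)ᴴ * W hn θ φ k = 1 := by
  induction k with
  | zero => simp [W]
  | succ k ih =>
    rw [W, Matrix.conjTranspose_mul, Matrix.mul_assoc, ← Matrix.mul_assoc _ (W hn θ φ k), ih,
      Matrix.one_mul, rot_unitary (pivot_lt hn k).ne]

lemma approxJacobi_of_approxAngles {n : ℕ} (hn : 2 ≤ n) {η : ℝ} {G : Matrix (Fin n) (Fin n) ℂ}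
    (hG : G.IsHermitian) {θ φ : ℕ → ℝ}
    (h : ∀ k, ApproxAngles η ((W hn θ φ k)ᴴ * G * W hn θ φ k) (pivot n hn k).1 (pivot n hn k).2
      (θ k) (φ k)) :
    ApproxJacobi hn ((1 - 2 * η) / 2) (5 / 2 * η ^ 2 * ‖G‖ ^ 2) θ φ
      fun k => (W hn θ φ k)ᴴ * G * W hn θ φ k where
  herm k := Matrix.isHermitian_conjTranspose_mul_mul _ hG
  step k := by simp only [W, Matrix.conjTranspose_mul, Matrix.mul_assoc]
  cos_sq k := (h k).cos_sq
  pivot_entry k := by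
    have := (h k).pivot_entry_le (Matrix.isHermitian_conjTranspose_mul_mul _ hG) (pivot_lt hn k).ne
    rw [frobenius_unitary_conj _ _ (W_unitary hn θ φ k)] at this
    simpa only [W, Matrix.conjTranspose_mul, Matrix.mul_assoc] using this

/-! ### The asymptotic bound -/

lemma sweepLength_cast {n : ℕ} (hn : 2 ≤ n) :
    (sweepLength (n - 1) : ℝ) = ((n : ℝ) ^ 2 - n) / 2 := by
  have h := Finset.sum_range_id_mul_two n
  rw [sweepLength, show n - 1 + 1 = n by omega]
  have h2 : ((∑ i ∈ Finset.range n, i : ℕ) : ℝ) * 2 = n * (n - 1 : ℕ) := by exact_mod_cast h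
  rw [Nat.cast_sub (by omega)] at h2
  push_cast at h2 ⊢
  linarith

lemma sweepExp_cast {n : ℕ} (hn : 2 ≤ n) :
    (sweepExp (n - 1) : ℝ) = ((n : ℝ) - 2) * ((n : ℝ) - 1) / 2 := by
  have h := Finset.sum_range_id_mul_two (n - 1)
  have h2 : ((∑ i ∈ Finset.range (n - 1), i : ℕ) : ℝ) * 2 = (n - 1 : ℕ) * (n - 1 - 1 : ℕ) := by
    exact_mod_cast h
  rw [Nat.sub_sub, Nat.cast_sub (by omega), Nat.cast_sub (by omega)] at h2
  rw [sweepExp]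
  push_cast at h2 ⊢
  linarith

lemma bound_eq {n : ℕ} (hn : 2 ≤ n) (η : ℝ) (G : Matrix (Fin n) (Fin n) ℂ) :
    bound n η G = 2 * sweepLength (n - 1) * (7 + 2 * Real.sqrt 2) * η ^ 2 * ‖G‖ ^ 2 *
      2 ^ sweepExp (n - 1) := by
  rw [bound, ← sweepExp_cast hn, Real.rpow_neg two_pos.le, Real.rpow_natCast, div_inv_eq_mul,
    sweepLength_cast hn]
  ring

/-- Smallness of `η` forces `η ≤ 1/6` and `Mη ≤ 1/6`, because `39 > 36`. Bernoulli's inequality then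
gives `(1 - 2η)^M ≥ 2/3`, and the left side is at most `7 · (5/2) · 2^M = 17.5 · 2^M`. -/
lemma sweep_constant_le {T M : ℕ} {η : ℝ} (hη : 0 ≤ η) (hMT : M + 1 ≤ T)
    (h : 39 * T * η ^ 2 * 2 ^ M ≤ 1) :
    0 < (1 - 2 * η) / 2 ∧ (4 / ((1 - 2 * η) / 2) ^ M + 1) * (5 / 2) ≤ 2 * 9.8 * 2 ^ M := by
  have hM2 : (M : ℝ) ≤ 2 ^ M := by exact_mod_cast Nat.lt_two_pow_self.le
  have h12 : (1 : ℝ) ≤ 2 ^ M := one_le_pow₀ one_le_two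
  have hT : (M : ℝ) + 1 ≤ T := by exact_mod_cast hMT
  have hM0 : (0 : ℝ) ≤ M := M.cast_nonneg
  have hTM : ((M : ℝ) ^ 2 + 1) ≤ T * 2 ^ M := by nlinarith
  have h1 : 39 * η ^ 2 * ((M : ℝ) ^ 2 + 1) ≤ 1 := by
    nlinarith [mul_le_mul_of_nonneg_left hTM (sq_nonneg η)]
  have hη6 : η ≤ 1 / 6 := by
    by_contra hc
    push Not at hc
    nlinarith [mul_nonneg (sq_nonneg η) (sq_nonneg (M : ℝ))]
  have hMη : M * η ≤ 1 / 6 := by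
    by_contra hc
    push Not at hc
    nlinarith [sq_nonneg η, mul_nonneg hM0 hη]
  refine ⟨by linarith, ?_⟩
  have hb : 2 / 3 ≤ (1 - 2 * η) ^ M := by
    have := one_add_mul_le_pow (a := -(2 * η)) (by linarith) M
    rw [← sub_eq_add_neg 1 (2 * η)] at this
    linarith
  have hdiv : 4 / ((1 - 2 * η) / 2) ^ M ≤ 6 * 2 ^ M := by
    rw [div_pow, div_div_eq_mul_div, div_le_iff₀ (by linarith)]
    nlinarith
  linarith

theorem ApproxJacobi.limsup_le {n : ℕ} {hn : 2 ≤ n} {η : ℝ} (hη : 0 < η)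
    {G : Matrix (Fin n) (Fin n) ℂ} {θ φ : ℕ → ℝ} {A : ℕ → Matrix (Fin n) (Fin n) ℂ}
    (hA : ApproxJacobi hn ((1 - 2 * η) / 2) (5 / 2 * η ^ 2 * ‖G‖ ^ 2) θ φ A)
    (hnorm : ∀ k, ‖A k‖ ^ 2 = ‖G‖ ^ 2) :
    IsBoundedUnder (· ≤ ·) atTop (fun k => offNorm (A k) ^ 2) ∧
      limsup (fun k => offNorm (A k) ^ 2) atTop ≤ bound n η G := by
  have hle : ∀ k, offNorm (A k) ^ 2 ≤ ‖G‖ ^ 2 / 2 := fun k => by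
    have := two_mul_offNorm_sq_le (hA.herm k)
    rw [hnorm k] at this
    linarith
  refine ⟨isBoundedUnder_of ⟨_, hle⟩, ?_⟩
  have hcob : IsCoboundedUnder (· ≤ ·) atTop (fun k => offNorm (A k) ^ 2) :=
    (isBoundedUnder_of ⟨0, fun k => sq_nonneg _⟩ : IsBoundedUnder (· ≥ ·) atTop
      (fun k => offNorm (A k) ^ 2)).isCoboundedUnder_le
  refine le_of_forall_pos_le_add fun δ hδ => ?_
  refine limsup_le_of_le hcob ?_
  set T := sweepLength (n - 1) with hT
  set M := sweepExp (n - 1) with hM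
  have hMT : M + 1 ≤ T := by
    rw [hM, hT, sweepLength, Finset.sum_range_succ, ← sweepExp]; omega
  -- This yields `7 + 2√2 ≥ 9.8`.
  have hsqrt : 1.4 ≤ Real.sqrt 2 := Real.le_sqrt_of_sq_le (by norm_num)
  have hX : 0 ≤ T * η ^ 2 * ‖G‖ ^ 2 := by positivity
  have hb : 2 * 9.8 * 2 ^ M * (T * η ^ 2 * ‖G‖ ^ 2) ≤ bound n η G := by
    rw [bound_eq hn, ← hT, ← hM]
    have : 0 ≤ 2 ^ M * (T * η ^ 2 * ‖G‖ ^ 2) := by positivity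
    nlinarith
  -- The threshold 39 lies below `2 · 19.6`: in the second case the bound is at least
  -- `(19.6/39)‖G‖²`, which is no less than `‖G‖²/2`.
  by_cases h : 39 * T * η ^ 2 * 2 ^ M ≤ 1
  · obtain ⟨hκ, hc⟩ := sweep_constant_le hη.le hMT h
    filter_upwards [hA.eventually_le hκ (by positivity) hδ] with k hk
    have := mul_le_mul_of_nonneg_right hc hX
    rw [← hT, ← hM] at hk
    linarith
  · refine Filter.Eventually.of_forall fun k => (hle k).trans ?_
    push Not at h
    have := mul_le_mul_of_nonneg_right h.le (sq_nonneg ‖G‖)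
    have hpos : 0 ≤ (2 : ℝ) ^ M * (T * η ^ 2 * ‖G‖ ^ 2) := by positivity
    linarith

/-! ### Exact minimization up to a fixed accuracy -/

lemma S_rotCol_pi_div_four {n : ℕ} {A : Matrix (Fin n) (Fin n) ℂ} (hA : A.IsHermitian)
    {l m : Fin n} (h : l ≠ m) (φ : ℝ) :
    S A (rotCol l m (Real.pi / 4) φ) = ((A l l).re + (A m m).re) / 2
      + (A l m).re * Real.cos (1 * φ) + (A l m).im * Real.sin (1 * φ) := by
  rw [S_rotCol hA h, show 2 * (Real.pi / 4) = Real.pi / 2 by ring, Real.cos_pi_div_two,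
    Real.sin_pi_div_two, crossRe]
  simp only [one_mul]; ring

lemma approxAngles_of_searchAccuracy {n : ℕ} {hn : 2 ≤ n} {η : ℝ} {G : Matrix (Fin n) (Fin n) ℂ}
    (hG : G.IsHermitian) {θ φ : ℕ → ℝ} (h : SearchAccuracy hn G η θ φ) (k : ℕ) :
    ApproxAngles η ((W hn θ φ k)ᴴ * G * W hn θ φ k) (pivot n hn k).1 (pivot n hn k).2
      (θ k) (φ k) := by
  obtain ⟨⟨φJ, hφJ, hφ⟩, θt, hθt, hθ⟩ := h k
  have hA := Matrix.isHermitian_conjTranspose_mul_mul (W hn θ φ k) hG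
  have hlm := (pivot_lt hn k).ne
  simp only [S_rotCol_pi_div_four hA hlm] at hφJ
  simp only [S_rotCol hA hlm] at hθt
  refine ⟨⟨φJ, ?_, hφ⟩, ⟨wrap θt, ?_, hθ⟩, cos_sq_ge (abs_wrap_le ?_) hθ⟩
  · simpa [trigDeriv, crossIm] using
      trigDeriv_eq_zero_of_isArgmin one_pos (one_mul Real.pi) hφJ
  · have h2 := trigDeriv_eq_zero_of_isArgmin two_pos
      (show 2 * (Real.pi / 2) = Real.pi by ring) hθt
    simpa using trigDeriv_wrap (t := θt) h2
  · have := abs_le.2 hθt.1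
    linarith [Real.pi_pos]

/-! ### The one-bit line search -/

/-- For sinusoids the mean value is attained exactly at the midpoint. This is why one comparison of
the end points decides the bisection. -/
lemma trig_sub_eq (p q a b : ℝ) :
    (p * Real.cos b + q * Real.sin b) - (p * Real.cos a + q * Real.sin a)
      = 2 * Real.sin ((b - a) / 2) * trigDeriv p q ((b + a) / 2) := by
  have h1 := Real.cos_sub_cos b a
  have h2 := Real.sin_sub_sin b a
  rw [trigDeriv]
  linear_combination p * h1 + q * h2

section

variable {n : ℕ} {h : (Fin n → ℂ) → (Fin n → ℂ) → ℤ} {x : ℝ → Fin n → ℂ} {C p q ω L η : ℝ}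

/-- The bracket after `i` passes of the one-bit line search: the derivative of the objective
changes its sign from `-` to `+` on it. -/
structure Bracket (p q ω L : ℝ) (i : ℕ) (s : SearchState) : Prop where
  length : s.zmax - s.zmin = L / 2 / 2 ^ i
  mem : s.z ∈ Icc s.zmin s.zmax
  left : trigDeriv p q (ω * s.zmin) ≤ 0
  right : 0 ≤ trigDeriv p q (ω * s.zmax)
  lower : -(3 * L / 4) ≤ s.zmin
  upper : s.zmax ≤ 5 * L / 4

/-- The bits are the truth values of `p ≤ q` and `0 ≤ p + q`. Up to a positive factor, `q - p` and
`p + q` are the derivatives at the phases `π/4` and `-π/4`; a shift by `π` gives the other possible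
bracket ends. -/
lemma bracket_searchInit (hω : 0 < ω) (hL : ω * L = Real.pi)
    (hx : ∀ s t, h (x s) (x t) = 1 ↔ C + p * Real.cos (ω * t) + q * Real.sin (ω * t)
      ≤ C + p * Real.cos (ω * s) + q * Real.sin (ω * s)) :
    Bracket p q ω L 0 (searchInit h L x) := by
  have hL0 : 0 < L := pos_of_mul_pos_right (hL ▸ Real.pi_pos) hω.le
  have ha : h (x (-L)) (x (-(L / 2))) = 1 ↔ p ≤ q := by
    rw [hx, show ω * -(L / 2) = -(Real.pi / 2) by rw [← hL]; ring,
      show ω * -L = -Real.pi by rw [← hL]; ring]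
    simp only [Real.cos_neg, Real.sin_neg, Real.cos_pi_div_two, Real.sin_pi_div_two, Real.cos_pi,
      Real.sin_pi]
    constructor <;> intro <;> linarith
  have hb : h (x 0) (x (-(L / 2))) = 1 ↔ 0 ≤ p + q := by
    rw [hx, show ω * -(L / 2) = -(Real.pi / 2) by rw [← hL]; ring, mul_zero]
    simp only [Real.cos_neg, Real.sin_neg, Real.cos_pi_div_two, Real.sin_pi_div_two, Real.cos_zero,
      Real.sin_zero]
    constructor <;> intro <;> linarith
  have hr : 0 < Real.sqrt 2 / 2 := by positivity
  have d1 : trigDeriv p q (Real.pi / 4) = Real.sqrt 2 / 2 * (q - p) := by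
    rw [trigDeriv, Real.sin_pi_div_four, Real.cos_pi_div_four]; ring
  have d2 : trigDeriv p q (-(Real.pi / 4)) = Real.sqrt 2 / 2 * (p + q) := by
    rw [trigDeriv, Real.sin_neg, Real.cos_neg, Real.sin_pi_div_four, Real.cos_pi_div_four]; ring
  have d3 : trigDeriv p q (-(3 * Real.pi / 4)) = Real.sqrt 2 / 2 * (p - q) := by
    rw [show -(3 * Real.pi / 4) = Real.pi / 4 - Real.pi by ring, trigDeriv_sub_pi, d1]; ring
  have d4 : trigDeriv p q (3 * Real.pi / 4) = Real.sqrt 2 / 2 * (-(p + q)) := by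
    rw [show 3 * Real.pi / 4 = -(Real.pi / 4) + Real.pi by ring, trigDeriv_add_pi, d2]; ring
  have d5 : trigDeriv p q (5 * Real.pi / 4) = Real.sqrt 2 / 2 * (p - q) := by
    rw [show 5 * Real.pi / 4 = Real.pi / 4 + Real.pi by ring, trigDeriv_add_pi, d1]; ring
  have main : ∀ z : ℝ, -(3 * L / 4) ≤ z - L / 2 → z ≤ 5 * L / 4 →
      trigDeriv p q (ω * (z - L / 2)) ≤ 0 → 0 ≤ trigDeriv p q (ω * z) →
      Bracket p q ω L 0 ⟨z - L / 2, z, z⟩ := fun z h1 h2 h3 h4 =>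
    ⟨by simp, ⟨by simp only; linarith, le_rfl⟩, h3, h4, h1, h2⟩
  unfold searchInit
  simp only [ha, hb]
  apply main
  · split_ifs <;> linarith
  · split_ifs <;> linarith
  · split_ifs with h1 h2 h2
    · rw [show ω * ((3 + 2 * 1 - 2 * 1 * (1 + 2 * 1)) * L / 4 - L / 2) = -(3 * (ω * L) / 4) by ring,
        hL, d3]
      exact mul_nonpos_of_nonneg_of_nonpos hr.le (by linarith)
    · rw [show ω * ((3 + 2 * 1 - 2 * 0 * (1 + 2 * 1)) * L / 4 - L / 2) = 3 * (ω * L) / 4 by ring,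
        hL, d4]
      exact mul_nonpos_of_nonneg_of_nonpos hr.le (by linarith)
    · rw [show ω * ((3 + 2 * 0 - 2 * 1 * (1 + 2 * 0)) * L / 4 - L / 2) = -(ω * L / 4) by ring,
        hL, d2]
      exact mul_nonpos_of_nonneg_of_nonpos hr.le (by linarith)
    · rw [show ω * ((3 + 2 * 0 - 2 * 0 * (1 + 2 * 0)) * L / 4 - L / 2) = ω * L / 4 by ring,
        hL, d1]
      exact mul_nonpos_of_nonneg_of_nonpos hr.le (by linarith)
  · split_ifs with h1 h2 h2
    · rw [show ω * ((3 + 2 * 1 - 2 * 1 * (1 + 2 * 1)) * L / 4) = -(ω * L / 4) by ring,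
        hL, d2]
      exact mul_nonneg hr.le (by linarith)
    · rw [show ω * ((3 + 2 * 1 - 2 * 0 * (1 + 2 * 1)) * L / 4) = 5 * (ω * L) / 4 by ring,
        hL, d5]
      exact mul_nonneg hr.le (by linarith)
    · rw [show ω * ((3 + 2 * 0 - 2 * 1 * (1 + 2 * 0)) * L / 4) = ω * L / 4 by ring,
        hL, d1]
      exact mul_nonneg hr.le (by linarith)
    · rw [show ω * ((3 + 2 * 0 - 2 * 0 * (1 + 2 * 0)) * L / 4) = 3 * (ω * L) / 4 by ring,
        hL, d4]
      exact mul_nonneg hr.le (by linarith)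

lemma Bracket.searchStep (hω : 0 < ω) (hL : ω * L = Real.pi)
    (hx : ∀ s t, h (x s) (x t) = 1 ↔ C + p * Real.cos (ω * t) + q * Real.sin (ω * t)
      ≤ C + p * Real.cos (ω * s) + q * Real.sin (ω * s))
    {i : ℕ} {s : SearchState} (hs : Bracket p q ω L i s) :
    Bracket p q ω L (i + 1) (searchStep h x s) := by
  have hL0 : 0 < L := pos_of_mul_pos_right (hL ▸ Real.pi_pos) hω.le
  have hlen := hs.length
  have hpos : 0 < s.zmax - s.zmin := by rw [hlen]; positivity
  have hle : s.zmax - s.zmin ≤ L / 2 := by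
    rw [hlen]
    exact div_le_self (by positivity) (one_le_pow₀ one_le_two)
  -- The bracket has phase length at most `π/2`, so the sine factor does not affect the sign.
  have hsin : 0 < Real.sin ((ω * s.zmax - ω * s.zmin) / 2) := by
    rw [← mul_sub]
    refine Real.sin_pos_of_pos_of_lt_pi (by positivity) ?_
    have := mul_le_mul_of_nonneg_left hle hω.le
    have hpi := Real.pi_pos
    linarith
  have hiff : h (x s.zmax) (x s.zmin) = 1
      ↔ 0 ≤ trigDeriv p q (ω * ((s.zmax + s.zmin) / 2)) := by
    rw [hx, ← mul_nonneg_iff_of_pos_left (mul_pos two_pos hsin),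
      show ω * ((s.zmax + s.zmin) / 2) = (ω * s.zmax + ω * s.zmin) / 2 by ring, ← trig_sub_eq]
    constructor <;> intro <;> linarith
  have hl := hs.lower
  have hu := hs.upper
  unfold OBNSLA.searchStep
  simp only [hiff]
  split_ifs with hc
  · refine ⟨?_, ⟨?_, le_rfl⟩, hs.left, hc, hl, ?_⟩ <;> simp only
    · rw [pow_succ, ← div_div, ← hlen]; ring
    · linarith
    · linarith
  · refine ⟨?_, ⟨le_rfl, ?_⟩, (not_le.1 hc).le, hs.right, ?_, hu⟩ <;> simp only
    · rw [pow_succ, ← div_div, ← hlen]; ring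
    · linarith
    · linarith

/-- The output of the one-bit line search is within `η` of a critical point of the objective. -/
lemma oneBitLineSearch_spec (hω : 0 < ω) (hL : ω * L = Real.pi) (hη : 0 < η)
    (hx : ∀ s t, h (x s) (x t) = 1 ↔ C + p * Real.cos (ω * t) + q * Real.sin (ω * t)
      ≤ C + p * Real.cos (ω * s) + q * Real.sin (ω * s)) :
    (∃ t₀, trigDeriv p q (ω * t₀) = 0 ∧ |oneBitLineSearch h L η x - t₀| ≤ η) ∧
      -(3 * L / 4) ≤ oneBitLineSearch h L η x ∧ oneBitLineSearch h L η x ≤ 5 * L / 4 := by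
  have hL0 : 0 < L := pos_of_mul_pos_right (hL ▸ Real.pi_pos) hω.le
  have hbr : ∀ i, Bracket p q ω L i ((searchStep h x)^[i] (searchInit h L x)) := by
    intro i
    induction i with
    | zero => exact bracket_searchInit hω hL hx
    | succ i ih =>
      rw [Function.iterate_succ_apply']
      exact ih.searchStep hω hL hx
  have hne : {i : ℕ | |((searchStep h x)^[i] (searchInit h L x)).zmax
      - ((searchStep h x)^[i] (searchInit h L x)).zmin| < η}.Nonempty := by
    obtain ⟨i, hi⟩ := exists_pow_lt_of_lt_one (div_pos hη (half_pos hL0))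
      (by norm_num : (1 / 2 : ℝ) < 1)
    refine ⟨i, ?_⟩
    rw [mem_ofPred_eq, (hbr i).length, abs_of_pos (by positivity)]
    rw [lt_div_iff₀ (by positivity), one_div, inv_pow] at hi
    rwa [div_eq_mul_inv, mul_comm]
  -- Termination matters here: `sInf` of an empty set would be the default `0`, with no information
  -- on the bracket length.
  have hlast := Nat.sInf_mem hne
  unfold oneBitLineSearch
  set i := sInf {i : ℕ | |((searchStep h x)^[i] (searchInit h L x)).zmax
      - ((searchStep h x)^[i] (searchInit h L x)).zmin| < η}
  have hb := hbr i
  rw [mem_ofPred_eq] at hlast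
  set s := (searchStep h x)^[i] (searchInit h L x)
  obtain ⟨hz1, hz2⟩ := hb.mem
  refine ⟨?_, by linarith [hb.lower], by linarith [hb.upper]⟩
  have hcont : ContinuousOn (fun t => trigDeriv p q (ω * t)) (Icc s.zmin s.zmax) := by
    unfold trigDeriv
    fun_prop
  obtain ⟨t₀, ht, h0⟩ := intermediate_value_Icc (hz1.trans hz2) hcont ⟨hb.left, hb.right⟩
  refine ⟨t₀, h0, ?_⟩
  have := (abs_lt.1 hlast).2
  rw [abs_le]
  constructor <;> linarith [ht.1, ht.2]

end

/-! ### The algorithm -/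

lemma S_channel {r n : ℕ} (H : Matrix (Fin r) (Fin n) ℂ) (V : Matrix (Fin n) (Fin n) ℂ)
    (x : Fin n → ℂ) :
    S (Vᴴ * (Hᴴ * H) * V) x = ‖WithLp.toLp 2 (H *ᵥ (V *ᵥ x))‖ ^ 2 := by
  have : star x ⬝ᵥ ((Vᴴ * (Hᴴ * H) * V) *ᵥ x)
      = star (H *ᵥ (V *ᵥ x)) ⬝ᵥ (H *ᵥ (V *ᵥ x)) := by
    rw [Matrix.star_mulVec, Matrix.star_mulVec]
    simp only [← Matrix.mulVec_mulVec, Matrix.dotProduct_mulVec]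
  rw [S, this, EuclideanSpace.norm_sq_eq, dotProduct, Complex.re_sum]
  refine Finset.sum_congr rfl fun i _ => ?_
  rw [Pi.star_apply, Complex.star_def, ← Complex.normSq_eq_conj_mul_self, Complex.ofReal_re,
    Complex.normSq_eq_norm_sq]

lemma oneBit_eq_one_iff {r n : ℕ} (H : Matrix (Fin r) (Fin n) ℂ) (V : Matrix (Fin n) (Fin n) ℂ)
    (x y : Fin n → ℂ) :
    oneBit H (V *ᵥ x) (V *ᵥ y) = 1
      ↔ S (Vᴴ * (Hᴴ * H) * V) y ≤ S (Vᴴ * (Hᴴ * H) * V) x := by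
  rw [S_channel, S_channel, sq_le_sq₀ (norm_nonneg _) (norm_nonneg _), oneBit]
  split_ifs with h
  · simpa using h
  · simpa using h

lemma approxAngles_oneBit {r n : ℕ} {η : ℝ} (hη : 0 < η) (H : Matrix (Fin r) (Fin n) ℂ)
    (V : Matrix (Fin n) (Fin n) ℂ) {l m : Fin n} (hlm : l ≠ m) :
    ApproxAngles η (Vᴴ * (Hᴴ * H) * V) l m (thetaHat (oneBit H) η V l m)
      (phiHat (oneBit H) η V l m) := by
  have hA : (Vᴴ * (Hᴴ * H) * V).IsHermitian :=
    Matrix.isHermitian_conjTranspose_mul_mul _ (Matrix.isHermitian_conjTranspose_mul_self H)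
  have hpi := Real.pi_pos
  obtain ⟨⟨φ', hφ, hφη⟩, -⟩ := oneBitLineSearch_spec (h := oneBit H)
    (x := fun t => V *ᵥ rotCol l m (Real.pi / 4) t) one_pos (one_mul Real.pi) hη
    (fun s t => by rw [oneBit_eq_one_iff, S_rotCol_pi_div_four hA hlm,
      S_rotCol_pi_div_four hA hlm])
  obtain ⟨⟨θ', hθ, hθη⟩, hlo, hhi⟩ := oneBitLineSearch_spec (h := oneBit H)
    (x := fun t => V *ᵥ rotCol l m t (phiHat (oneBit H) η V l m)) two_pos
    (show 2 * (Real.pi / 2) = Real.pi by ring) hη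
    (fun s t => by rw [oneBit_eq_one_iff, S_rotCol hA hlm, S_rotCol hA hlm])
  set z := oneBitLineSearch (oneBit H) (Real.pi / 2) η
    fun t => V *ᵥ rotCol l m t (phiHat (oneBit H) η V l m) with hz
  -- The critical angle is shifted by the same multiple of `π/2` as the output `z`. For the cosine
  -- bound θ serves as its own reference angle, as `z ∈ [-3π/8, 5π/8]` reduces into `[-π/4, π/4]`.
  refine ⟨⟨φ', by simpa [trigDeriv, crossIm] using hφ, hφη⟩, ⟨_, trigDeriv_wrap (t := z) hθ, ?_⟩,
    cos_sq_ge (θ' := thetaHat (oneBit H) η V l m) (abs_wrap_le ?_) (by simpa using hη.le)⟩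
  · rw [thetaHat, ← hz]
    convert hθη using 2
    ring
  · rw [abs_le]
    constructor <;> linarith

lemma algW_eq_W {n : ℕ} (hn : 2 ≤ n) (h : (Fin n → ℂ) → (Fin n → ℂ) → ℤ) (η : ℝ) (k : ℕ) :
    algW hn h η k = W hn
      (fun k => thetaHat h η (algW hn h η k) (pivot n hn k).1 (pivot n hn k).2)
      (fun k => phiHat h η (algW hn h η k) (pivot n hn k).1 (pivot n hn k).2) k := by
  induction k with
  | zero => rfl
  | succ k ih => rw [algW, W, ← ih]

end OBNSLA

/-! ### The main theorem -/

theorem corollary1 (n : ℕ) (hn : 2 ≤ n) (η : ℝ) (hη : 0 < η) :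
    (∀ (G : Matrix (Fin n) (Fin n) ℂ), G.IsHermitian →
      ∀ (θ φ : ℕ → ℝ), OBNSLA.SearchAccuracy hn G η θ φ →
        Filter.IsBoundedUnder (· ≤ ·) Filter.atTop
          (fun k => OBNSLA.offNorm ((OBNSLA.W hn θ φ k)ᴴ * G * OBNSLA.W hn θ φ k) ^ 2) ∧
        Filter.limsup
          (fun k => OBNSLA.offNorm ((OBNSLA.W hn θ φ k)ᴴ * G * OBNSLA.W hn θ φ k) ^ 2)
          Filter.atTop ≤ OBNSLA.bound n η G) ∧
    (∀ (r : ℕ) (H : Matrix (Fin r) (Fin n) ℂ),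
        Filter.IsBoundedUnder (· ≤ ·) Filter.atTop
          (fun k => OBNSLA.offNorm ((OBNSLA.algW hn (OBNSLA.oneBit H) η k)ᴴ * (Hᴴ * H) *
            OBNSLA.algW hn (OBNSLA.oneBit H) η k) ^ 2) ∧
        Filter.limsup
          (fun k => OBNSLA.offNorm ((OBNSLA.algW hn (OBNSLA.oneBit H) η k)ᴴ * (Hᴴ * H) *
            OBNSLA.algW hn (OBNSLA.oneBit H) η k) ^ 2)
          Filter.atTop ≤ OBNSLA.bound n η (Hᴴ * H)) := by
  refine ⟨fun G hG θ φ h => ?_, fun r H => ?_⟩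
  · exact (OBNSLA.approxJacobi_of_approxAngles hn hG
      (OBNSLA.approxAngles_of_searchAccuracy hG h)).limsup_le hη
        fun k => OBNSLA.frobenius_unitary_conj _ _ (OBNSLA.W_unitary hn θ φ k)
  -- The angles chosen adaptively by the algorithm are regarded as fixed sequences, so that the
  -- general result on rotations applies.
  · have hW := OBNSLA.algW_eq_W hn (OBNSLA.oneBit H) η
    set θ : ℕ → ℝ := fun k => OBNSLA.thetaHat (OBNSLA.oneBit H) η
      (OBNSLA.algW hn (OBNSLA.oneBit H) η k) (OBNSLA.pivot n hn k).1 (OBNSLA.pivot n hn k).2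
    set φ : ℕ → ℝ := fun k => OBNSLA.phiHat (OBNSLA.oneBit H) η
      (OBNSLA.algW hn (OBNSLA.oneBit H) η k) (OBNSLA.pivot n hn k).1 (OBNSLA.pivot n hn k).2
    have hacc := fun k => OBNSLA.approxAngles_oneBit hη H (OBNSLA.algW hn (OBNSLA.oneBit H) η k)
      (OBNSLA.pivot_lt hn k).ne
    have key := (OBNSLA.approxJacobi_of_approxAngles (θ := θ) (φ := φ) hn
      (Matrix.isHermitian_conjTranspose_mul_self H) fun k => by
        rw [← hW k]; exact hacc k).limsup_le hη
        fun k => OBNSLA.frobenius_unitary_conj _ _ (OBNSLA.W_unitary hn θ φ k)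
    simp only [← hW] at key
    exact key
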